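/- Let $N\ge 5$ and let $a_1,a_2\in\mathbb{R}^N$ be two distinct points. Let $D^{2,2}(\mathbb{R}^N)$ be the completion of the space $C_0^\infty(\mathbb{R}^N)$ of real-valued smooth compactly supported functions in the norm $\|\Delta u\|_{L^2(\mathbb{R}^N)}$; since $N\ge5$, it is a space of functions contained in $L^{2N/(N-4)}(\mathbb{R}^N)$, whose elements have a weak Laplacian $\Delta u\in L^2(\mathbb{R}^N)$. Then: (i) for every $u\in C_0^\infty(\mathbb{R}^N)$ both integrals below are finite and $$\int_{\mathbb{R}^N}|\Delta u|^2\,dx\;\ge\;\frac{N^2(N-4)^2}{16}\int_{\mathbb{R}^N}\frac{|a_1-a_2|^4}{|x-a_1|^4|x-a_2|^4}\,|u|^2\,dx ;$$ (ii) the constant is sharp: for every $u\in D^{2,2}(\mathbb{R}^N)\setminus\{0\}$ the integral on the right is finite and positive, and $$\frac{N^2(N-4)^2}{16}=\inf_{u\in D^{2,2}(\mathbb{R}^N)\setminus\{0\}}\;\frac{\int_{\mathbb{R}^N}|\Delta u|^2\,dx}{\int_{\mathbb{R}^N}\frac{|a_1-a_2|^4}{|x-a_1|^4|x-a_2|^4}|u|^2\,dx};$$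 (iii) this infimum is not attained: there is no $u\in D^{2,2}(\mathbb{R}^N)\setminus\{0\}$ for which equality holds in the inequality of (i). -/

import Mathlib

open MeasureTheory Filter Topology
open scoped ContDiff

noncomputable section

/-- `u ∈ C_0^∞(ℝ^N)`: smooth, real-valued and compactly supported. -/
def IsTestFun {N : ℕ} (u : EuclideanSpace ℝ (Fin N) → ℝ) : Prop :=
  ContDiff ℝ ∞ u ∧ HasCompactSupport u

/-- The critical Sobolev exponent `2N/(N-4)` of `D^{2,2}(ℝ^N)`, meant for `N ≥ 5`. -/
def sobolevExp (N : ℕ) : ENNReal :=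
  ENNReal.ofReal (2 * (N : ℝ) / ((N : ℝ) - 4))

/-- `HasD22Laplacian u g`: the function `u` is in `D^{2,2}(ℝ^N)`, and `g` is its (weak) Laplacian.

`D^{2,2}(ℝ^N)` is the completion of `C_0^∞(ℝ^N)` for the norm `‖Δu‖_{L²}`. For `N ≥ 5` the Sobolev
inequality `‖u‖_{2N/(N-4)} ≤ C ‖Δu‖_2` on `C_0^∞(ℝ^N)` makes it a space of functions: its elements
are the limits `u` in `L^{2N/(N-4)}` of sequences `φ k` of test functions for which `Δ (φ k)` is
Cauchy, that is converges to some `g`, in `L²`. The norm of `u` in the completion is then `‖g‖_2`. -/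
def HasD22Laplacian {N : ℕ} (u g : EuclideanSpace ℝ (Fin N) → ℝ) : Prop :=
  MemLp u (sobolevExp N) volume ∧ MemLp g 2 volume ∧
    ∃ φ : ℕ → EuclideanSpace ℝ (Fin N) → ℝ,
      (∀ k, IsTestFun (φ k)) ∧
      Tendsto (fun k => eLpNorm (φ k - u) (sobolevExp N) volume) atTop (𝓝 0) ∧
      Tendsto (fun k => eLpNorm (Laplacian.laplacian (φ k) - g) 2 volume) atTop (𝓝 0)

/-- The bipolar weight `|a₁ - a₂|⁴ / (|x - a₁|⁴ |x - a₂|⁴)`. -/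
def bipolarWeight {N : ℕ} (a₁ a₂ x : EuclideanSpace ℝ (Fin N)) : ℝ :=
  ‖a₁ - a₂‖ ^ 4 / (‖x - a₁‖ ^ 4 * ‖x - a₂‖ ^ 4)

/-- The constant `N² (N - 4)² / 16`. -/
def rellichConst (N : ℕ) : ℝ :=
  (N : ℝ) ^ 2 * ((N : ℝ) - 4) ^ 2 / 16

end

/-! Write `d = |a₁ - a₂|` and `γ = N(N-4)/4`, so that the constant is `γ²`. The inequality comes
from completing one square in inverted coordinates. For `u` vanishing near the poles put `v = u/|x -
a₁|²`; then `∫ |Δu|² = ∫ (|x - a₁|² Δv)²` by `integral_laplacian_normSq_mul_sq`. Expanding `(|x -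
a₁|² Δv + γ d² v/|x - a₂|²)² ≥ 0` leaves a cross term `∫ (u/|x - a₂|²) Δv`, which is second order
only. It has the form `∫ α f Δ(β f)`, where `f = (|x - a₁| |x - a₂|)^{(N-4)/2} u` and `α`, `β` are
bipolar powers of total degree `2 - N`. For such powers `laplacian_bipolarPow` gives a single term
proportional to `d²`, so the ground state identity `integral_ground_state` evaluates the cross term
exactly. The result, `improved_rellich`, keeps a remainder `2γd² ∫ (|x - a₁| |x - a₂|)^{2-N} |∇f|²`.

To reach all of `D^{2,2}`, cutoffs near the poles cost little energy because `t⁻⁴ t^N` tends to zero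
(`exists_cutoff`), and Fatou's lemma passes to the limit.

If equality holds for some `u`, the remainder along an approximating sequence must vanish in the
limit. No weak gradient is introduced: the remainder controls translation differences of `f` on
balls, so the limiting `f` is invariant under all translations and hence constant. A nonzero
constant would make the weighted square of `u` a multiple of `(|x - a₁| |x - a₂|)^{-N}`, which is
not integrable at a pole.

The constant cannot be improved because near `a₁` the weight looks like `|x - a₁|⁻⁴`. In the
variable `t = log |x - a₁|` the functions `|x - a₁|^{-(N-4)/2} ψ(t)` turn the Laplacian into a
constant coefficient operator with zeroth order coefficient `-γ`. A widely stretched bump `ψ`,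
shifted towards `t = -∞`, makes the derivative terms negligible. -/

noncomputable section

variable {N : ℕ}

/-! ### Calculus of directional derivatives and Laplacians. -/

/-- Directional derivative of `f` in the direction `w`. -/
def dirDeriv {N : ℕ} (w : EuclideanSpace ℝ (Fin N)) (f : EuclideanSpace ℝ (Fin N) → ℝ) :
    EuclideanSpace ℝ (Fin N) → ℝ := fun x => fderiv ℝ f x w

/-- The `i`-th partial derivative. -/
abbrev pd {N : ℕ} (i : Fin N) (f : EuclideanSpace ℝ (Fin N) → ℝ) :
    EuclideanSpace ℝ (Fin N) → ℝ := dirDeriv (EuclideanSpace.single i 1) f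

/-- The Euler operator `v ↦ (x - a) · ∇v` centred at `a`. -/
def eulerOp {N : ℕ} (a : EuclideanSpace ℝ (Fin N)) (f : EuclideanSpace ℝ (Fin N) → ℝ) :
    EuclideanSpace ℝ (Fin N) → ℝ := fun x => fderiv ℝ f x (x - a)


theorem dirDeriv_congr {w x : EuclideanSpace ℝ (Fin N)} {f g : EuclideanSpace ℝ (Fin N) → ℝ}
    (h : f =ᶠ[𝓝 x] g) : dirDeriv w f =ᶠ[𝓝 x] dirDeriv w g := by
  filter_upwards [h.fderiv (𝕜 := ℝ)] with y hy
  simp [dirDeriv, hy]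

theorem ContDiffAt.dirDeriv {w x : EuclideanSpace ℝ (Fin N)} {f : EuclideanSpace ℝ (Fin N) → ℝ}
    (hf : ContDiffAt ℝ ∞ f x) : ContDiffAt ℝ ∞ (dirDeriv w f) x := by
  have h : ContDiffAt ℝ ∞ (fderiv ℝ f) x := hf.fderiv_right (m := ∞) (by simp)
  exact h.clm_apply contDiffAt_const

theorem ContDiff.dirDeriv {w : EuclideanSpace ℝ (Fin N)} {f : EuclideanSpace ℝ (Fin N) → ℝ}
    (hf : ContDiff ℝ ∞ f) : ContDiff ℝ ∞ (dirDeriv w f) :=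
  (hf.fderiv_right (m := ∞) (by simp)).clm_apply contDiff_const

theorem HasCompactSupport.dirDeriv {w : EuclideanSpace ℝ (Fin N)}
    {f : EuclideanSpace ℝ (Fin N) → ℝ} (hf : HasCompactSupport f) :
    HasCompactSupport (dirDeriv w f) :=
  hf.fderiv_apply ℝ w

theorem dirDeriv_add {w x : EuclideanSpace ℝ (Fin N)} {f g : EuclideanSpace ℝ (Fin N) → ℝ}
    (hf : DifferentiableAt ℝ f x) (hg : DifferentiableAt ℝ g x) :
    dirDeriv w (fun y => f y + g y) x = dirDeriv w f x + dirDeriv w g x := by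
  simp [dirDeriv, fderiv_fun_add hf hg]

theorem dirDeriv_mul {w x : EuclideanSpace ℝ (Fin N)} {f g : EuclideanSpace ℝ (Fin N) → ℝ}
    (hf : DifferentiableAt ℝ f x) (hg : DifferentiableAt ℝ g x) :
    dirDeriv w (fun y => f y * g y) x = f x * dirDeriv w g x + g x * dirDeriv w f x := by
  simp [dirDeriv, fderiv_fun_mul hf hg]

theorem laplacian_eq_sum_pd {x : EuclideanSpace ℝ (Fin N)} {f : EuclideanSpace ℝ (Fin N) → ℝ}
    (hf : ContDiffAt ℝ 2 f x) : Laplacian.laplacian f x = ∑ i, pd i (pd i f) x := by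
  rw [InnerProductSpace.laplacian_eq_iteratedFDeriv_orthonormalBasis f
    (EuclideanSpace.basisFun (Fin N) ℝ)]
  refine Finset.sum_congr rfl fun i _ => ?_
  have h : DifferentiableAt ℝ (fderiv ℝ f) x :=
    (hf.fderiv_right (m := 1) (by norm_num)).differentiableAt (by norm_num)
  rw [iteratedFDeriv_two_apply]
  simp only [dirDeriv, EuclideanSpace.basisFun_apply, Matrix.cons_val_zero, Matrix.cons_val_one]
  change _ = fderiv ℝ (fun y => fderiv ℝ f y (EuclideanSpace.single i 1)) x _
  rw [fderiv_clm_apply h (differentiableAt_const _)]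
  simp

theorem ContDiffAt.diffAt {x : EuclideanSpace ℝ (Fin N)} {f : EuclideanSpace ℝ (Fin N) → ℝ}
    (hf : ContDiffAt ℝ ∞ f x) : DifferentiableAt ℝ f x := hf.differentiableAt (by simp)

theorem ContDiffAt.two {x : EuclideanSpace ℝ (Fin N)} {f : EuclideanSpace ℝ (Fin N) → ℝ}
    (hf : ContDiffAt ℝ ∞ f x) : ContDiffAt ℝ 2 f x := by
  exact_mod_cast contDiffAt_infty.1 hf 2

theorem ContDiffAt.eventually_diffAt {x : EuclideanSpace ℝ (Fin N)}
    {f : EuclideanSpace ℝ (Fin N) → ℝ}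
    (hf : ContDiffAt ℝ ∞ f x) : ∀ᶠ y in 𝓝 x, DifferentiableAt ℝ f y := by
  have h1 : ContDiffAt ℝ 1 f x := by exact_mod_cast contDiffAt_infty.1 hf 1
  filter_upwards [h1.eventually (by simp)] with y hy
  exact hy.differentiableAt (by simp)

theorem dirDeriv_dirDeriv_mul {w x : EuclideanSpace ℝ (Fin N)}
    {f g : EuclideanSpace ℝ (Fin N) → ℝ}
    (hf : ContDiffAt ℝ ∞ f x) (hg : ContDiffAt ℝ ∞ g x) :
    dirDeriv w (dirDeriv w (fun y => f y * g y)) x = f x * dirDeriv w (dirDeriv w g) x +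
      2 * (dirDeriv w f x * dirDeriv w g x) + g x * dirDeriv w (dirDeriv w f) x := by
  have h : dirDeriv w (fun y => f y * g y) =ᶠ[𝓝 x]
      fun y => f y * dirDeriv w g y + g y * dirDeriv w f y := by
    filter_upwards [hf.eventually_diffAt, hg.eventually_diffAt] with y h1 h2
    exact dirDeriv_mul h1 h2
  have hf' := hf.diffAt
  have hg' := hg.diffAt
  have hdf := (hf.dirDeriv (w := w)).diffAt
  have hdg := (hg.dirDeriv (w := w)).diffAt
  rw [(dirDeriv_congr h).eq_of_nhds, dirDeriv_add (hf'.fun_mul hdg) (hg'.fun_mul hdf),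
    dirDeriv_mul hf' hdg, dirDeriv_mul hg' hdf]
  ring

theorem laplacian_mul {x : EuclideanSpace ℝ (Fin N)} {f g : EuclideanSpace ℝ (Fin N) → ℝ}
    (hf : ContDiffAt ℝ ∞ f x) (hg : ContDiffAt ℝ ∞ g x) :
    Laplacian.laplacian (fun y => f y * g y) x = f x * Laplacian.laplacian g x +
      2 * ∑ i, pd i f x * pd i g x + g x * Laplacian.laplacian f x := by
  rw [laplacian_eq_sum_pd (hf.mul hg).two, laplacian_eq_sum_pd hf.two, laplacian_eq_sum_pd hg.two]
  simp only [pd, dirDeriv_dirDeriv_mul hf hg, Finset.sum_add_distrib, Finset.mul_sum]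

theorem laplacian_contDiff {f : EuclideanSpace ℝ (Fin N) → ℝ} (hf : ContDiff ℝ ∞ f) :
    ContDiff ℝ ∞ (Laplacian.laplacian f) := by
  have : Laplacian.laplacian f = fun x => ∑ i, pd i (pd i f) x := by
    ext x; exact laplacian_eq_sum_pd hf.contDiffAt.two
  rw [this]
  exact ContDiff.sum fun i _ => hf.dirDeriv.dirDeriv

theorem laplacian_zero_of_eventually {f : EuclideanSpace ℝ (Fin N) → ℝ}
    {x : EuclideanSpace ℝ (Fin N)} (h : f =ᶠ[𝓝 x] 0) : Laplacian.laplacian f x = 0 := by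
  have h0 : Laplacian.laplacian f x =
      Laplacian.laplacian (fun _ : EuclideanSpace ℝ (Fin N) => (0 : ℝ)) x :=
    (InnerProductSpace.laplacian_congr_nhds h).eq_of_nhds
  rw [h0, InnerProductSpace.laplacian_const]; rfl

theorem laplacian_hasCompactSupport {f : EuclideanSpace ℝ (Fin N) → ℝ}
    (hf : HasCompactSupport f) : HasCompactSupport (Laplacian.laplacian f) := by
  refine HasCompactSupport.intro' (K := tsupport f) hf (isClosed_tsupport f) fun x hx => ?_
  exact laplacian_zero_of_eventually (notMem_tsupport_iff_eventuallyEq.1 hx)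

/-! ### Test functions: stability and integration by parts. -/

theorem IsTestFun.laplacian {f : EuclideanSpace ℝ (Fin N) → ℝ} (hf : IsTestFun f) :
    IsTestFun (Laplacian.laplacian f) :=
  ⟨laplacian_contDiff hf.1, laplacian_hasCompactSupport hf.2⟩

theorem IsTestFun.dirDeriv {f : EuclideanSpace ℝ (Fin N) → ℝ} (hf : IsTestFun f)
    (w : EuclideanSpace ℝ (Fin N)) : IsTestFun (dirDeriv w f) :=
  ⟨hf.1.dirDeriv, hf.2.dirDeriv⟩

theorem IsTestFun.smooth_mul {f g : EuclideanSpace ℝ (Fin N) → ℝ} (hf : ContDiff ℝ ∞ f)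
    (hg : IsTestFun g) : IsTestFun (fun x => f x * g x) :=
  ⟨hf.mul hg.1, hg.2.mul_left⟩

theorem IsTestFun.add {f g : EuclideanSpace ℝ (Fin N) → ℝ} (hf : IsTestFun f)
    (hg : IsTestFun g) : IsTestFun (fun x => f x + g x) :=
  ⟨hf.1.add hg.1, hf.2.add hg.2⟩

theorem IsTestFun.integrable {f : EuclideanSpace ℝ (Fin N) → ℝ} (hf : IsTestFun f) :
    Integrable f := hf.1.continuous.integrable_of_hasCompactSupport hf.2

theorem IsTestFun.memLp {f : EuclideanSpace ℝ (Fin N) → ℝ} (hf : IsTestFun f) (p : ENNReal) :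
    MemLp f p volume := hf.1.continuous.memLp_of_hasCompactSupport hf.2

theorem integral_mul_dirDeriv {f g : EuclideanSpace ℝ (Fin N) → ℝ} (hf : ContDiff ℝ ∞ f)
    (hg : IsTestFun g) (w : EuclideanSpace ℝ (Fin N)) :
    ∫ x, f x * dirDeriv w g x = - ∫ x, dirDeriv w f x * g x :=
  integral_mul_fderiv_eq_neg_fderiv_mul_of_integrable
    (IsTestFun.smooth_mul hf.dirDeriv hg).integrable
    (IsTestFun.smooth_mul hf (hg.dirDeriv w)).integrable
    (IsTestFun.smooth_mul hf hg).integrable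
    (fun _ _ => hf.contDiffAt.diffAt) (fun _ _ => hg.1.contDiffAt.diffAt)

theorem integral_dirDeriv_eq_zero {g : EuclideanSpace ℝ (Fin N) → ℝ}
    (hg : IsTestFun g) (w : EuclideanSpace ℝ (Fin N)) : ∫ x, dirDeriv w g x = 0 := by
  have := integral_mul_dirDeriv (f := fun _ => (1 : ℝ)) contDiff_const hg w
  simpa [dirDeriv] using this

theorem integral_mul_laplacian {f g : EuclideanSpace ℝ (Fin N) → ℝ} (hf : ContDiff ℝ ∞ f)
    (hg : IsTestFun g) :
    ∫ x, f x * Laplacian.laplacian g x = ∫ x, Laplacian.laplacian f x * g x := by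
  simp only [laplacian_eq_sum_pd hg.1.contDiffAt.two, laplacian_eq_sum_pd hf.contDiffAt.two,
    Finset.mul_sum, Finset.sum_mul]
  rw [integral_finsetSum, integral_finsetSum]
  · refine Finset.sum_congr rfl fun i _ => ?_
    rw [integral_mul_dirDeriv hf (hg.dirDeriv _), integral_mul_dirDeriv hf.dirDeriv hg, neg_neg]
  · exact fun i _ => (IsTestFun.smooth_mul hf.dirDeriv.dirDeriv hg).integrable
  · exact fun i _ => (IsTestFun.smooth_mul hf ((hg.dirDeriv _).dirDeriv _)).integrable

/-! ### The Euler operator and the invariance of the Rellich energy under inversion -/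

theorem eulerOp_contDiff {a : EuclideanSpace ℝ (Fin N)} {f : EuclideanSpace ℝ (Fin N) → ℝ}
    (hf : ContDiff ℝ ∞ f) : ContDiff ℝ ∞ (eulerOp a f) :=
  (hf.fderiv_right (m := ∞) (by simp)).clm_apply (contDiff_id.sub contDiff_const)

theorem IsTestFun.eulerOp {f : EuclideanSpace ℝ (Fin N) → ℝ} (hf : IsTestFun f)
    (a : EuclideanSpace ℝ (Fin N)) : IsTestFun (eulerOp a f) := by
  refine ⟨eulerOp_contDiff hf.1, ?_⟩
  refine HasCompactSupport.intro' (K := tsupport f) hf.2 (isClosed_tsupport f) fun x hx => ?_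
  have : fderiv ℝ f x = 0 := by
    have h := (notMem_tsupport_iff_eventuallyEq.1 hx).fderiv_eq (𝕜 := ℝ)
    rw [h]; exact fderiv_const_apply (0 : ℝ)
  simp [_root_.eulerOp, this]

theorem eulerOp_eq_sum (a : EuclideanSpace ℝ (Fin N)) (f : EuclideanSpace ℝ (Fin N) → ℝ)
    (x : EuclideanSpace ℝ (Fin N)) : eulerOp a f x = ∑ i, (x i - a i) * pd i f x := by
  have h : x - a = ∑ i, (x i - a i) • EuclideanSpace.single i (1 : ℝ) := by
    conv_lhs => rw [← (EuclideanSpace.basisFun (Fin N) ℝ).sum_repr (x - a)]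
    simp
  simp only [eulerOp, pd, dirDeriv]
  conv_lhs => rw [h]
  rw [map_sum]
  simp

theorem dirDeriv_coord_sub (a w x : EuclideanSpace ℝ (Fin N)) (i : Fin N) :
    dirDeriv w (fun y : EuclideanSpace ℝ (Fin N) => y i - a i) x = w i := by
  have : HasFDerivAt (fun y : EuclideanSpace ℝ (Fin N) => y i - a i)
      (EuclideanSpace.proj i : EuclideanSpace ℝ (Fin N) →L[ℝ] ℝ) x :=
    (EuclideanSpace.proj i : EuclideanSpace ℝ (Fin N) →L[ℝ] ℝ).hasFDerivAt.sub_const _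
  simp [dirDeriv, this.fderiv]

theorem contDiff_coord_sub (a : EuclideanSpace ℝ (Fin N)) (i : Fin N) :
    ContDiff ℝ ∞ (fun y : EuclideanSpace ℝ (Fin N) => y i - a i) := by fun_prop

/-- The field `x - a` has divergence `N`. -/
theorem integral_eulerOp {f : EuclideanSpace ℝ (Fin N) → ℝ} (hf : IsTestFun f)
    (a : EuclideanSpace ℝ (Fin N)) : ∫ x, eulerOp a f x = - N * ∫ x, f x := by
  simp only [eulerOp_eq_sum]
  rw [integral_finsetSum]
  · simp only [integral_mul_dirDeriv (contDiff_coord_sub a _) hf, dirDeriv_coord_sub]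
    simp
  · exact fun i _ => (IsTestFun.smooth_mul (contDiff_coord_sub a i) (hf.dirDeriv _)).integrable

theorem eulerOp_mul {a x : EuclideanSpace ℝ (Fin N)} {f g : EuclideanSpace ℝ (Fin N) → ℝ}
    (hf : DifferentiableAt ℝ f x) (hg : DifferentiableAt ℝ g x) :
    eulerOp a (fun y => f y * g y) x = f x * eulerOp a g x + g x * eulerOp a f x := by
  simp [eulerOp, fderiv_fun_mul hf hg]

theorem dirDeriv_eulerOp {a w x : EuclideanSpace ℝ (Fin N)} {f : EuclideanSpace ℝ (Fin N) → ℝ}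
    (hf : ContDiff ℝ ∞ f) :
    dirDeriv w (eulerOp a f) x = eulerOp a (dirDeriv w f) x + dirDeriv w f x := by
  have hd : DifferentiableAt ℝ (fderiv ℝ f) x :=
    ((hf.fderiv_right (m := ∞) (by simp)).differentiable (by simp)) x
  have hs : IsSymmSndFDerivAt ℝ f x := hf.contDiffAt.two.isSymmSndFDerivAt (by simp)
  change fderiv ℝ (fun y => fderiv ℝ f y (y - a)) x w =
    fderiv ℝ (fun y => fderiv ℝ f y w) x (x - a) + fderiv ℝ f x w
  rw [fderiv_clm_apply hd (by fun_prop), fderiv_clm_apply hd (by fun_prop)]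
  simp [hs.eq w x, hs.eq w a, fderiv_sub_const, add_comm]

/-- The commutator `[Δ, E] = 2Δ` expresses that `Δ` is homogeneous of degree `-2` under the
dilations generated by `E`. Each partial derivative contributes one unit, by symmetry of second
derivatives. -/
theorem laplacian_eulerOp {a x : EuclideanSpace ℝ (Fin N)} {f : EuclideanSpace ℝ (Fin N) → ℝ}
    (hf : ContDiff ℝ ∞ f) :
    Laplacian.laplacian (eulerOp a f) x =
      eulerOp a (Laplacian.laplacian f) x + 2 * Laplacian.laplacian f x := by
  have h1 : ∀ i, pd i (pd i (eulerOp a f)) x =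
      eulerOp a (pd i (pd i f)) x + 2 * pd i (pd i f) x := by
    intro i
    have : pd i (eulerOp a f) = fun y => eulerOp a (pd i f) y + pd i f y := by
      ext y; exact dirDeriv_eulerOp hf
    rw [this, pd, dirDeriv_add (eulerOp_contDiff hf.dirDeriv).contDiffAt.diffAt
      hf.dirDeriv.contDiffAt.diffAt, dirDeriv_eulerOp hf.dirDeriv]
    ring
  rw [laplacian_eq_sum_pd (eulerOp_contDiff hf).contDiffAt.two,
    laplacian_eq_sum_pd hf.contDiffAt.two, Finset.sum_congr rfl fun i _ => h1 i,
    Finset.sum_add_distrib, Finset.mul_sum]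
  congr 1
  have : Laplacian.laplacian f = fun y => ∑ i, pd i (pd i f) y := by
    ext y; exact laplacian_eq_sum_pd hf.contDiffAt.two
  rw [this]
  simp only [eulerOp]
  rw [fderiv_fun_sum fun i _ => hf.dirDeriv.dirDeriv.contDiffAt.diffAt]
  simp

theorem contDiff_normSq_sub (a : EuclideanSpace ℝ (Fin N)) :
    ContDiff ℝ ∞ (fun x : EuclideanSpace ℝ (Fin N) => ‖x - a‖ ^ 2) :=
  (contDiff_id.sub contDiff_const).norm_sq ℝ

theorem fderiv_normSq_sub (a x w : EuclideanSpace ℝ (Fin N)) :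
    fderiv ℝ (fun x : EuclideanSpace ℝ (Fin N) => ‖x - a‖ ^ 2) x w = 2 * inner ℝ (x - a) w := by
  have : HasFDerivAt (fun x : EuclideanSpace ℝ (Fin N) => ‖x - a‖ ^ 2) _ x :=
    ((hasFDerivAt_id x).sub_const a).norm_sq
  rw [this.fderiv]
  simp [inner_sub_left]

theorem pd_normSq_sub (a x : EuclideanSpace ℝ (Fin N)) (i : Fin N) :
    pd i (fun x : EuclideanSpace ℝ (Fin N) => ‖x - a‖ ^ 2) x = 2 * (x i - a i) := by
  simp [pd, dirDeriv, fderiv_normSq_sub, EuclideanSpace.inner_single_right]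

theorem laplacian_normSq_sub (a x : EuclideanSpace ℝ (Fin N)) :
    Laplacian.laplacian (fun x : EuclideanSpace ℝ (Fin N) => ‖x - a‖ ^ 2) x = 2 * N := by
  rw [laplacian_eq_sum_pd (contDiff_normSq_sub a).contDiffAt.two]
  have : ∀ i, pd i (pd i (fun x : EuclideanSpace ℝ (Fin N) => ‖x - a‖ ^ 2)) x = 2 := by
    intro i
    have h : pd i (fun x : EuclideanSpace ℝ (Fin N) => ‖x - a‖ ^ 2) =
        fun y => 2 * (y i - a i) := by ext y; exact pd_normSq_sub a y i
    rw [h, pd, dirDeriv_mul (by fun_prop) (by fun_prop), dirDeriv_coord_sub]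
    simp [dirDeriv]
  simp [this, mul_comm]

theorem laplacian_normSq_mul {v : EuclideanSpace ℝ (Fin N) → ℝ} (hv : ContDiff ℝ ∞ v)
    (a x : EuclideanSpace ℝ (Fin N)) :
    Laplacian.laplacian (fun y => ‖y - a‖ ^ 2 * v y) x =
      ‖x - a‖ ^ 2 * Laplacian.laplacian v x + (4 * eulerOp a v x + 2 * N * v x) := by
  rw [laplacian_mul (contDiff_normSq_sub a).contDiffAt hv.contDiffAt, laplacian_normSq_sub,
    eulerOp_eq_sum]
  simp only [pd_normSq_sub, Finset.mul_sum]
  rw [Finset.sum_congr rfl fun i _ => show 2 * (2 * (x i - a i) * pd i v x) =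
    4 * ((x i - a i) * pd i v x) by ring]
  ring

theorem eulerOp_normSq (a x : EuclideanSpace ℝ (Fin N)) :
    eulerOp a (fun y : EuclideanSpace ℝ (Fin N) => ‖y - a‖ ^ 2) x = 2 * ‖x - a‖ ^ 2 := by
  rw [eulerOp, fderiv_normSq_sub, real_inner_self_eq_norm_sq]

/-- The Rellich energy of `|x - a|² v` equals the `|x - a|⁴`-weighted Rellich energy of `v`:
this is the invariance of `∫ |Δu|²` under the Kelvin transform centred at `a`. -/
theorem integral_laplacian_normSq_mul_sq {v : EuclideanSpace ℝ (Fin N) → ℝ} (hv : IsTestFun v)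
    (a : EuclideanSpace ℝ (Fin N)) :
    ∫ x, (Laplacian.laplacian (fun y => ‖y - a‖ ^ 2 * v y) x) ^ 2 =
      ∫ x, (‖x - a‖ ^ 2 * Laplacian.laplacian v x) ^ 2 := by
  have hr := contDiff_normSq_sub a
  have hrv : IsTestFun (fun y => ‖y - a‖ ^ 2 * v y) := .smooth_mul hr hv
  -- `4H` is the commutator of `Δ` with multiplication by `|x - a|²`, applied to `v`. The shift
  -- `N/2` makes the operator `v ↦ H` skew-adjoint.
  set H : EuclideanSpace ℝ (Fin N) → ℝ := fun x => eulerOp a v x + N / 2 * v x with hH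
  have hHt : IsTestFun H := (hv.eulerOp a).add (.smooth_mul contDiff_const hv)
  have hL : ∀ x, Laplacian.laplacian (fun y => ‖y - a‖ ^ 2 * v y) x =
      ‖x - a‖ ^ 2 * Laplacian.laplacian v x + 4 * H x := by
    intro x; rw [laplacian_normSq_mul hv.1, hH]; ring
  have hLH : ∀ x, Laplacian.laplacian H x =
      eulerOp a (Laplacian.laplacian v) x + (2 + N / 2) * Laplacian.laplacian v x := by
    intro x
    have e : H = (eulerOp a v) + (N / 2 : ℝ) • v := by ext x; simp [hH]
    have h1 : ContDiffAt ℝ 2 (eulerOp a v) x := (eulerOp_contDiff hv.1).contDiffAt.two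
    have h2 : ContDiffAt ℝ 2 v x := hv.1.contDiffAt.two
    have h3 : ContDiffAt ℝ 2 ((N / 2 : ℝ) • v) x := contDiffAt_const.smul h2
    rw [e, h1.laplacian_add h3, InnerProductSpace.laplacian_smul _ h2,
      laplacian_eulerOp hv.1]
    simp; ring
  -- After moving `Δ` onto `H`, the two integrands add up to `E(F) + N F` with `F = Δv · |x - a|²
  -- v`, which is the divergence of `(x - a) F`.
  have key : ∫ x, H x * Laplacian.laplacian (fun y => ‖y - a‖ ^ 2 * v y) x =
      - ∫ x, H x * (‖x - a‖ ^ 2 * Laplacian.laplacian v x) := by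
    rw [integral_mul_laplacian hHt.1 hrv]
    have hprod : IsTestFun (fun x => Laplacian.laplacian v x * (‖x - a‖ ^ 2 * v x)) :=
      .smooth_mul (laplacian_contDiff hv.1) hrv
    have hE := integral_eulerOp hprod a
    have hE' : ∀ x, eulerOp a (fun x => Laplacian.laplacian v x * (‖x - a‖ ^ 2 * v x)) x =
        Laplacian.laplacian H x * (‖x - a‖ ^ 2 * v x) +
        H x * (‖x - a‖ ^ 2 * Laplacian.laplacian v x) -
        N * (Laplacian.laplacian v x * (‖x - a‖ ^ 2 * v x)) := by
      intro x
      rw [eulerOp_mul (laplacian_contDiff hv.1).contDiffAt.diffAt hrv.1.contDiffAt.diffAt,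
        eulerOp_mul hr.contDiffAt.diffAt hv.1.contDiffAt.diffAt, eulerOp_normSq, hLH, hH]
      ring
    simp only [hE'] at hE
    have i1 : Integrable (fun x => Laplacian.laplacian H x * (‖x - a‖ ^ 2 * v x)) :=
      (IsTestFun.smooth_mul (laplacian_contDiff hHt.1) hrv).integrable
    have i2 : Integrable (fun x => H x * (‖x - a‖ ^ 2 * Laplacian.laplacian v x)) :=
      (IsTestFun.smooth_mul hHt.1 (.smooth_mul hr hv.laplacian)).integrable
    have i12 : Integrable (fun x => Laplacian.laplacian H x * (‖x - a‖ ^ 2 * v x) +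
      H x * (‖x - a‖ ^ 2 * Laplacian.laplacian v x)) := i1.add i2
    rw [integral_sub i12 (hprod.integrable.const_mul _), integral_add i1 i2,
      integral_const_mul] at hE
    linarith
  have i1 : Integrable (fun x => (‖x - a‖ ^ 2 * Laplacian.laplacian v x) ^ 2) := by
    simp only [pow_two (‖_‖ ^ 2 * Laplacian.laplacian v _)]
    exact (IsTestFun.smooth_mul (hr.mul (laplacian_contDiff hv.1))
      (.smooth_mul hr hv.laplacian)).integrable
  have i2 : Integrable (fun x => H x * Laplacian.laplacian (fun y => ‖y - a‖ ^ 2 * v y) x) :=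
    (IsTestFun.smooth_mul hHt.1 hrv.laplacian).integrable
  have i3 : Integrable (fun x => H x * (‖x - a‖ ^ 2 * Laplacian.laplacian v x)) :=
    (IsTestFun.smooth_mul hHt.1 (.smooth_mul hr hv.laplacian)).integrable
  -- The difference of squares factors as the difference `4H` times the sum, and `key` says that
  -- this product integrates to zero.
  have : ∀ x, (Laplacian.laplacian (fun y => ‖y - a‖ ^ 2 * v y) x) ^ 2 =
      (‖x - a‖ ^ 2 * Laplacian.laplacian v x) ^ 2 +
      4 * (H x * Laplacian.laplacian (fun y => ‖y - a‖ ^ 2 * v y) x +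
        H x * (‖x - a‖ ^ 2 * Laplacian.laplacian v x)) := by
    intro x; rw [hL]; ring
  simp only [this]
  have i23 : Integrable (fun x => H x * Laplacian.laplacian (fun y => ‖y - a‖ ^ 2 * v y) x +
    H x * (‖x - a‖ ^ 2 * Laplacian.laplacian v x)) := i2.add i3
  rw [integral_add i1 (i23.const_mul _), integral_const_mul, integral_add i2 i3, key]
  ring

/-! ### A ground state identity and the bipolar weights -/

/-- Allows multiplication by weights that are singular at the poles, provided the test function
vanishes near them. -/
theorem IsTestFun.mul_of_contDiffAt {f φ : EuclideanSpace ℝ (Fin N) → ℝ} (hf : IsTestFun f)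
    (hφ : ∀ x ∈ tsupport f, ContDiffAt ℝ ∞ φ x) : IsTestFun (fun x => φ x * f x) := by
  refine ⟨contDiff_iff_contDiffAt.2 fun x => ?_, hf.2.mul_left⟩
  by_cases hx : x ∈ tsupport f
  · exact (hφ x hx).mul hf.1.contDiffAt
  · have h : (fun x => φ x * f x) =ᶠ[𝓝 x] fun _ => 0 := by
      filter_upwards [notMem_tsupport_iff_eventuallyEq.1 hx] with y hy
      simp [hy]
    exact contDiffAt_const.congr_of_eventuallyEq h

theorem tsupport_mul_self_subset (f g : EuclideanSpace ℝ (Fin N) → ℝ) :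
    tsupport (fun x => f x * g x) ⊆ tsupport f := tsupport_mul_subset_left

theorem dirDeriv_sub {w x : EuclideanSpace ℝ (Fin N)} {f g : EuclideanSpace ℝ (Fin N) → ℝ}
    (hf : DifferentiableAt ℝ f x) (hg : DifferentiableAt ℝ g x) :
    dirDeriv w (fun y => f y - g y) x = dirDeriv w f x - dirDeriv w g x := by
  simp [dirDeriv, fderiv_fun_sub hf hg]

theorem dirDeriv_eq_zero_of_notMem {f : EuclideanSpace ℝ (Fin N) → ℝ}
    {x : EuclideanSpace ℝ (Fin N)} (hx : x ∉ tsupport f) (w : EuclideanSpace ℝ (Fin N)) :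
    dirDeriv w f x = 0 := by
  have h : fderiv ℝ f x = 0 := by
    rw [(notMem_tsupport_iff_eventuallyEq.1 hx).fderiv_eq (𝕜 := ℝ)]
    exact fderiv_const_apply (0 : ℝ)
  simp [dirDeriv, h]

/-- The energy identity behind Hardy-type inequalities: if `f` is a test function and `α`, `β` are
smooth on its support, then
`-∫ α f Δ(β f) = ∫ α β |∇f|² - ½ ∫ f² (α Δβ + β Δα)`. -/
theorem integral_ground_state {f α β : EuclideanSpace ℝ (Fin N) → ℝ} (hf : IsTestFun f)
    (hα : ∀ x ∈ tsupport f, ContDiffAt ℝ ∞ α x) (hβ : ∀ x ∈ tsupport f, ContDiffAt ℝ ∞ β x) :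
    Integrable (fun x => α x * f x * Laplacian.laplacian (fun y => β y * f y) x +
      α x * β x * ∑ i, (pd i f x) ^ 2 -
      (1 / 2) * (f x) ^ 2 * (α x * Laplacian.laplacian β x + β x * Laplacian.laplacian α x)) ∧
    ∫ x, (α x * f x * Laplacian.laplacian (fun y => β y * f y) x +
      α x * β x * ∑ i, (pd i f x) ^ 2 -
      (1 / 2) * (f x) ^ 2 * (α x * Laplacian.laplacian β x + β x * Laplacian.laplacian α x)) = 0 := by
  -- The integrand is the divergence of `αβ f∇f + ½ f² (α∇β - β∇α)`; the second summand symmetrises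
  -- the zeroth order terms in `α` and `β`.
  set G : Fin N → EuclideanSpace ℝ (Fin N) → ℝ := fun i x =>
    (α x * β x) * (f x * pd i f x) +
      ((1 / 2) * (α x * pd i β x - β x * pd i α x)) * (f x * f x) with hG
  have hGt : ∀ i, IsTestFun (G i) := fun i => by
    refine IsTestFun.add ?_ ?_
    · refine (IsTestFun.smooth_mul hf.1 (hf.dirDeriv _)).mul_of_contDiffAt fun x hx => ?_
      have hx' := tsupport_mul_self_subset _ _ hx
      exact (hα x hx').mul (hβ x hx')
    · refine (IsTestFun.smooth_mul hf.1 hf).mul_of_contDiffAt fun x hx => ?_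
      have hx' := tsupport_mul_self_subset _ _ hx
      exact contDiffAt_const.mul (((hα x hx').mul (hβ x hx').dirDeriv).sub
        ((hβ x hx').mul (hα x hx').dirDeriv))
  have hpt : ∀ x, α x * f x * Laplacian.laplacian (fun y => β y * f y) x +
      α x * β x * ∑ i, (pd i f x) ^ 2 -
      (1 / 2) * (f x) ^ 2 * (α x * Laplacian.laplacian β x + β x * Laplacian.laplacian α x) =
      ∑ i, pd i (G i) x := by
    intro x
    by_cases hx : x ∈ tsupport f
    · have ha := hα x hx
      have hb := hβ x hx
      have hfx : ContDiffAt ℝ ∞ f x := hf.1.contDiffAt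
      rw [laplacian_eq_sum_pd (hb.mul hfx).two, laplacian_eq_sum_pd ha.two,
        laplacian_eq_sum_pd hb.two]
      simp only [Finset.mul_sum]
      rw [← Finset.sum_add_distrib, ← Finset.sum_add_distrib, Finset.mul_sum,
        ← Finset.sum_sub_distrib]
      refine Finset.sum_congr rfl fun i _ => ?_
      have da := ha.diffAt
      have db := hb.diffAt
      have df := hfx.diffAt
      have da' := (ha.dirDeriv (w := EuclideanSpace.single i 1)).diffAt
      have db' := (hb.dirDeriv (w := EuclideanSpace.single i 1)).diffAt
      have df' := (hfx.dirDeriv (w := EuclideanSpace.single i 1)).diffAt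
      have e1 : pd i (G i) x = _ := dirDeriv_add ((da.fun_mul db).fun_mul (df.fun_mul df'))
        (((differentiableAt_const (1 / 2 : ℝ)).fun_mul
          ((da.fun_mul db').fun_sub (db.fun_mul da'))).fun_mul (df.fun_mul df))
      rw [e1, dirDeriv_mul (da.fun_mul db) (df.fun_mul df'), dirDeriv_mul da db,
        dirDeriv_mul df df', dirDeriv_mul ((differentiableAt_const (1 / 2 : ℝ)).fun_mul
          ((da.fun_mul db').fun_sub (db.fun_mul da'))) (df.fun_mul df), dirDeriv_mul df df,
        dirDeriv_mul (differentiableAt_const (1 / 2 : ℝ))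
          ((da.fun_mul db').fun_sub (db.fun_mul da')),
        dirDeriv_sub (da.fun_mul db') (db.fun_mul da'), dirDeriv_mul da db', dirDeriv_mul db da']
      simp only [pd]
      rw [dirDeriv_dirDeriv_mul hb hfx]
      have e2 : dirDeriv (EuclideanSpace.single i 1)
        (fun _ : EuclideanSpace ℝ (Fin N) => (1 / 2 : ℝ)) x = 0 := by simp [dirDeriv]
      rw [e2]
      ring
    · have h0 : f x = 0 := image_eq_zero_of_notMem_tsupport hx
      have h1 : ∀ i, pd i f x = 0 := fun i => dirDeriv_eq_zero_of_notMem hx _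
      have h2 : ∀ i, pd i (G i) x = 0 := fun i => by
        refine dirDeriv_eq_zero_of_notMem (fun h => hx ?_) _
        refine closure_minimal (fun y hy => ?_) (isClosed_tsupport f) h
        by_contra hy'
        exact hy (by simp [hG, image_eq_zero_of_notMem_tsupport hy'])
      simp [h0, h1, h2]
  simp only [hpt]
  refine ⟨integrable_finsetSum _ fun i _ => ((hGt i).dirDeriv _).integrable, ?_⟩
  rw [integral_finsetSum _ fun i _ => ((hGt i).dirDeriv _).integrable]
  exact Finset.sum_eq_zero fun i _ => integral_dirDeriv_eq_zero (hGt i) _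

theorem normSq_sub_pos {a x : EuclideanSpace ℝ (Fin N)} (h : x ≠ a) : 0 < ‖x - a‖ ^ 2 :=
  pow_pos (norm_pos_iff.2 (sub_ne_zero.2 h)) 2

theorem contDiffAt_normSq_rpow {a x : EuclideanSpace ℝ (Fin N)} (h : x ≠ a) (p : ℝ) :
    ContDiffAt ℝ ∞ (fun y : EuclideanSpace ℝ (Fin N) => (‖y - a‖ ^ 2) ^ p) x :=
  (contDiff_normSq_sub a).contDiffAt.rpow_const_of_ne (normSq_sub_pos h).ne'

theorem dirDeriv_normSq_rpow {a x : EuclideanSpace ℝ (Fin N)} (h : x ≠ a) (p : ℝ) (i : Fin N) :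
    pd i (fun y : EuclideanSpace ℝ (Fin N) => (‖y - a‖ ^ 2) ^ p) x =
      (2 * p) * ((‖x - a‖ ^ 2) ^ (p - 1) * (x i - a i)) := by
  have h1 : HasFDerivAt (fun y : EuclideanSpace ℝ (Fin N) => ‖y - a‖ ^ 2)
      (fderiv ℝ (fun y : EuclideanSpace ℝ (Fin N) => ‖y - a‖ ^ 2) x) x :=
    (contDiff_normSq_sub a).contDiffAt.diffAt.hasFDerivAt
  have h2 := h1.rpow_const (p := p) (Or.inl (normSq_sub_pos h).ne')
  have h3 := pd_normSq_sub a x i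
  simp only [pd, dirDeriv] at h3 ⊢
  rw [h2.fderiv]
  simp only [smul_apply, h3, smul_eq_mul]
  ring

theorem laplacian_normSq_rpow {a x : EuclideanSpace ℝ (Fin N)} (h : x ≠ a) (p : ℝ) :
    Laplacian.laplacian (fun y : EuclideanSpace ℝ (Fin N) => (‖y - a‖ ^ 2) ^ p) x =
      2 * p * (2 * p - 2 + N) * (‖x - a‖ ^ 2) ^ (p - 1) := by
  rw [laplacian_eq_sum_pd (contDiffAt_normSq_rpow h p).two]
  have hs := normSq_sub_pos h
  have h1 : ∀ i, pd i (pd i (fun y : EuclideanSpace ℝ (Fin N) => (‖y - a‖ ^ 2) ^ p)) x =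
      (2 * p) * ((‖x - a‖ ^ 2) ^ (p - 1) +
        2 * (p - 1) * (‖x - a‖ ^ 2) ^ (p - 1 - 1) * (x i - a i) ^ 2) := by
    intro i
    have e : pd i (fun y : EuclideanSpace ℝ (Fin N) => (‖y - a‖ ^ 2) ^ p) =ᶠ[𝓝 x]
        fun y => (2 * p) * ((‖y - a‖ ^ 2) ^ (p - 1) * (y i - a i)) := by
      filter_upwards [isOpen_ne.mem_nhds h] with y hy
      exact dirDeriv_normSq_rpow hy p i
    have d1 := (contDiffAt_normSq_rpow h (p - 1)).diffAt
    have d2 := (contDiff_coord_sub a i).contDiffAt.diffAt (x := x)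
    have e1 := dirDeriv_normSq_rpow h (p - 1) i
    have e2 : pd i (fun _ : EuclideanSpace ℝ (Fin N) => 2 * p) x = 0 := by simp [dirDeriv]
    simp only [pd] at e e1 e2 ⊢
    rw [(dirDeriv_congr e).eq_of_nhds, dirDeriv_mul (differentiableAt_const _) (d1.fun_mul d2),
      dirDeriv_mul d1 d2, dirDeriv_coord_sub, e1, e2,
      show (EuclideanSpace.single i (1 : ℝ)) i = (1 : ℝ) by simp]
    ring
  have h2 : ∑ i, (x i - a i) ^ 2 = ‖x - a‖ ^ 2 := by
    rw [EuclideanSpace.real_norm_sq_eq]; simp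
  simp only [h1, ← Finset.mul_sum, Finset.sum_add_distrib, h2]
  rw [mul_assoc (2 * (p - 1)), ← Real.rpow_add_one hs.ne']
  simp
  ring

/-- The product of powers `|x - a₁|^{2p} |x - a₂|^{2q}`. -/
def bipolarPow (a₁ a₂ : EuclideanSpace ℝ (Fin N)) (p q : ℝ) (x : EuclideanSpace ℝ (Fin N)) : ℝ :=
  (‖x - a₁‖ ^ 2) ^ p * (‖x - a₂‖ ^ 2) ^ q

theorem contDiffAt_bipolarPow {a₁ a₂ x : EuclideanSpace ℝ (Fin N)} (h₁ : x ≠ a₁) (h₂ : x ≠ a₂)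
    (p q : ℝ) : ContDiffAt ℝ ∞ (bipolarPow a₁ a₂ p q) x :=
  (contDiffAt_normSq_rpow h₁ p).mul (contDiffAt_normSq_rpow h₂ q)

/-- The law of cosines; this is where `|a₁ - a₂|²` enters the computation. -/
theorem two_mul_sum_sub_mul_sub (a₁ a₂ x : EuclideanSpace ℝ (Fin N)) :
    2 * ∑ i, (x i - a₁ i) * (x i - a₂ i) = ‖x - a₁‖ ^ 2 + ‖x - a₂‖ ^ 2 - ‖a₁ - a₂‖ ^ 2 := by
  simp only [EuclideanSpace.real_norm_sq_eq, ← Finset.sum_add_distrib, ← Finset.sum_sub_distrib,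
    Finset.mul_sum]
  refine Finset.sum_congr rfl fun i _ => ?_
  simp
  ring

/-- Under the degree condition the Laplacians of the two factors carry the same coefficient `-4pq`,
and they cancel against the `|x - a₁|²` and `|x - a₂|²` parts of the gradient term. Only the `|a₁ -
a₂|²` part survives. -/
theorem laplacian_bipolarPow {a₁ a₂ x : EuclideanSpace ℝ (Fin N)} (h₁ : x ≠ a₁) (h₂ : x ≠ a₂)
    {p q : ℝ} (hpq : 2 * p + 2 * q = 2 - N) :
    Laplacian.laplacian (bipolarPow a₁ a₂ p q) x =
      -(4 * p * q) * ‖a₁ - a₂‖ ^ 2 * bipolarPow a₁ a₂ (p - 1) (q - 1) x := by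
  have hs₁ := normSq_sub_pos h₁
  have hs₂ := normSq_sub_pos h₂
  have e := laplacian_mul (contDiffAt_normSq_rpow h₁ p) (contDiffAt_normSq_rpow h₂ q)
  change Laplacian.laplacian (bipolarPow a₁ a₂ p q) x = _ at e
  rw [e, laplacian_normSq_rpow h₁, laplacian_normSq_rpow h₂]
  simp only [dirDeriv_normSq_rpow h₁, dirDeriv_normSq_rpow h₂]
  have e1 : ∀ i, 2 * p * ((‖x - a₁‖ ^ 2) ^ (p - 1) * (x i - a₁ i)) *
      (2 * q * ((‖x - a₂‖ ^ 2) ^ (q - 1) * (x i - a₂ i))) =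
      (4 * p * q) * bipolarPow a₁ a₂ (p - 1) (q - 1) x * ((x i - a₁ i) * (x i - a₂ i)) := by
    intro i; rw [bipolarPow]; ring
  have e2 : (‖x - a₁‖ ^ 2) ^ p = (‖x - a₁‖ ^ 2) ^ (p - 1) * ‖x - a₁‖ ^ 2 := by
    rw [← Real.rpow_add_one hs₁.ne']; simp
  have e3 : (‖x - a₂‖ ^ 2) ^ q = (‖x - a₂‖ ^ 2) ^ (q - 1) * ‖x - a₂‖ ^ 2 := by
    rw [← Real.rpow_add_one hs₂.ne']; simp
  have e4 := two_mul_sum_sub_mul_sub a₁ a₂ x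
  simp only [e1, ← Finset.mul_sum]
  rw [mul_left_comm 2, e4, e2, e3, bipolarPow, show (N : ℝ) = 2 - 2 * p - 2 * q by linarith]
  ring

/-! ### The improved inequality away from the poles -/

/-- Test functions vanishing in a neighbourhood of the two poles. -/
def IsPuncturedTest (a₁ a₂ : EuclideanSpace ℝ (Fin N)) (u : EuclideanSpace ℝ (Fin N) → ℝ) : Prop :=
  IsTestFun u ∧ a₁ ∉ tsupport u ∧ a₂ ∉ tsupport u

theorem IsPuncturedTest.ne {a₁ a₂ x : EuclideanSpace ℝ (Fin N)}
    {u : EuclideanSpace ℝ (Fin N) → ℝ} (hu : IsPuncturedTest a₁ a₂ u) (hx : x ∈ tsupport u) :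
    x ≠ a₁ ∧ x ≠ a₂ :=
  ⟨fun h => hu.2.1 (h ▸ hx), fun h => hu.2.2 (h ▸ hx)⟩

/-- The quotient of `u` by the virtual ground state `(|x - a₁| |x - a₂|)^{-(N-4)/2}`. -/
def groundQuot (a₁ a₂ : EuclideanSpace ℝ (Fin N)) (u : EuclideanSpace ℝ (Fin N) → ℝ) :
    EuclideanSpace ℝ (Fin N) → ℝ :=
  fun x => bipolarPow a₁ a₂ (((N : ℝ) - 4) / 4) (((N : ℝ) - 4) / 4) x * u x

theorem IsPuncturedTest.groundQuot {a₁ a₂ : EuclideanSpace ℝ (Fin N)}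
    {u : EuclideanSpace ℝ (Fin N) → ℝ} (hu : IsPuncturedTest a₁ a₂ u) :
    IsTestFun (groundQuot a₁ a₂ u) :=
  hu.1.mul_of_contDiffAt fun _ hx => contDiffAt_bipolarPow (hu.ne hx).1 (hu.ne hx).2 _ _

theorem bipolarPow_mul {a₁ a₂ x : EuclideanSpace ℝ (Fin N)} (h₁ : x ≠ a₁) (h₂ : x ≠ a₂)
    (p q p' q' : ℝ) :
    bipolarPow a₁ a₂ p q x * bipolarPow a₁ a₂ p' q' x = bipolarPow a₁ a₂ (p + p') (q + q') x := by
  simp only [bipolarPow]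
  rw [Real.rpow_add (normSq_sub_pos h₁), Real.rpow_add (normSq_sub_pos h₂)]
  ring

theorem bipolarWeight_eq {a₁ a₂ x : EuclideanSpace ℝ (Fin N)} :
    bipolarWeight a₁ a₂ x = ‖a₁ - a₂‖ ^ 4 * bipolarPow a₁ a₂ (-2) (-2) x := by
  have e : ∀ a : EuclideanSpace ℝ (Fin N), (‖x - a‖ ^ 2) ^ (-2 : ℝ) = (‖x - a‖ ^ 4)⁻¹ := by
    intro a
    rw [Real.rpow_neg (by positivity), Real.rpow_two]
    ring
  rw [bipolarWeight, bipolarPow, e, e]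
  field_simp

theorem IsPuncturedTest.integrable_weight {a₁ a₂ : EuclideanSpace ℝ (Fin N)}
    {u : EuclideanSpace ℝ (Fin N) → ℝ} (hu : IsPuncturedTest a₁ a₂ u) :
    Integrable (fun x => bipolarWeight a₁ a₂ x * (u x) ^ 2) := by
  simp only [bipolarWeight_eq, pow_two (u _)]
  refine ((IsTestFun.smooth_mul hu.1.1 hu.1).mul_of_contDiffAt fun x hx => ?_).integrable
  have hx' := tsupport_mul_self_subset _ _ hx
  exact contDiffAt_const.mul (contDiffAt_bipolarPow (hu.ne hx').1 (hu.ne hx').2 _ _)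

theorem IsPuncturedTest.integrable_grad {a₁ a₂ : EuclideanSpace ℝ (Fin N)}
    {u : EuclideanSpace ℝ (Fin N) → ℝ} (hu : IsPuncturedTest a₁ a₂ u) :
    Integrable (fun x => bipolarPow a₁ a₂ (1 - N / 2) (1 - N / 2) x *
      ∑ i, (pd i (_root_.groundQuot a₁ a₂ u) x) ^ 2) := by
  have hft := hu.groundQuot
  simp only [Finset.mul_sum, pow_two (pd _ _ _)]
  refine integrable_finsetSum _ fun i _ => ?_
  refine ((IsTestFun.smooth_mul hft.1.dirDeriv (hft.dirDeriv _)).mul_of_contDiffAt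
    fun x hx => ?_).integrable
  have hx' : x ∈ tsupport u := tsupport_mul_subset_right
    (tsupport_fderiv_apply_subset ℝ _ (tsupport_mul_self_subset _ _ hx))
  exact contDiffAt_bipolarPow (hu.ne hx').1 (hu.ne hx').2 _ _

/-- The cross term of the completed square yields `2γ²` times the weighted integral plus the
gradient remainder, while the square itself takes back `γ²`. The remainder is kept because
non-attainment rests on it. -/
theorem improved_rellich {a₁ a₂ : EuclideanSpace ℝ (Fin N)}
    {u : EuclideanSpace ℝ (Fin N) → ℝ} (hu : IsPuncturedTest a₁ a₂ u) :
    rellichConst N * (∫ x, bipolarWeight a₁ a₂ x * (u x) ^ 2) +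
      (N * ((N : ℝ) - 4) / 2 * ‖a₁ - a₂‖ ^ 2) *
        ∫ x, bipolarPow a₁ a₂ (1 - N / 2) (1 - N / 2) x *
          ∑ i, (pd i (groundQuot a₁ a₂ u) x) ^ 2 ≤
      ∫ x, (Laplacian.laplacian u x) ^ 2 := by
  set f := groundQuot a₁ a₂ u with hf
  have hft : IsTestFun f := hu.groundQuot
  have hfs : tsupport f ⊆ tsupport u := tsupport_mul_subset_right
  set γ : ℝ := N * ((N : ℝ) - 4) / 4 with hγ
  set v : EuclideanSpace ℝ (Fin N) → ℝ := fun x => (‖x - a₁‖ ^ 2) ^ (-1 : ℝ) * u x with hv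
  have hvt : IsTestFun v :=
    hu.1.mul_of_contDiffAt fun _ hx => contDiffAt_normSq_rpow (hu.ne hx).1 _
  have hu0 : ∀ x, (x = a₁ ∨ x = a₂) → u x = 0 := by
    rintro x (rfl | rfl)
    exacts [image_eq_zero_of_notMem_tsupport hu.2.1, image_eq_zero_of_notMem_tsupport hu.2.2]
  have huv : (fun y => ‖y - a₁‖ ^ 2 * v y) = u := by
    ext x
    by_cases hx : x = a₁
    · rw [hv]; simp [hu0 x (.inl hx)]
    · have := norm_ne_zero_iff.2 (sub_ne_zero.2 hx)
      rw [hv]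
      simp only [Real.rpow_neg_one]
      field_simp
  -- The exponents are forced by `β f = u/|x - a₁|²` and `α f = u/|x - a₂|²`. Both pairs satisfy `2p
  -- + 2q = 2 - N` and `4pq = γ`.
  set α := bipolarPow a₁ a₂ (-((N : ℝ) - 4) / 4) (-(N : ℝ) / 4) with hα
  set β := bipolarPow a₁ a₂ (-(N : ℝ) / 4) (-((N : ℝ) - 4) / 4) with hβ
  have hαs : ∀ x ∈ tsupport f, ContDiffAt ℝ ∞ α x := fun x hx =>
    contDiffAt_bipolarPow (hu.ne (hfs hx)).1 (hu.ne (hfs hx)).2 _ _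
  have hβs : ∀ x ∈ tsupport f, ContDiffAt ℝ ∞ β x := fun x hx =>
    contDiffAt_bipolarPow (hu.ne (hfs hx)).1 (hu.ne (hfs hx)).2 _ _
  have hβf : (fun y => β y * f y) = v := by
    ext x
    by_cases hx : x = a₁ ∨ x = a₂
    · simp [hf, hv, groundQuot, hu0 x hx]
    · push Not at hx
      have := bipolarPow_mul hx.1 hx.2 (-(N : ℝ) / 4) (-((N : ℝ) - 4) / 4)
        (((N : ℝ) - 4) / 4) (((N : ℝ) - 4) / 4)
      simp only [hf, groundQuot, hβ, hv]
      rw [← mul_assoc, this, show -(N : ℝ) / 4 + (N - 4) / 4 = -1 by ring,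
        show -((N : ℝ) - 4) / 4 + (N - 4) / 4 = 0 by ring]
      simp [bipolarPow]
  have hαf : ∀ x, α x * f x = (‖x - a₂‖ ^ 2)⁻¹ * u x := by
    intro x
    by_cases hx : x = a₁ ∨ x = a₂
    · simp [hf, groundQuot, hu0 x hx]
    · push Not at hx
      have := bipolarPow_mul hx.1 hx.2 (-((N : ℝ) - 4) / 4) (-(N : ℝ) / 4)
        (((N : ℝ) - 4) / 4) (((N : ℝ) - 4) / 4)
      simp only [hf, groundQuot, hα]
      rw [← mul_assoc, this, show -(N : ℝ) / 4 + (N - 4) / 4 = -1 by ring,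
        show -((N : ℝ) - 4) / 4 + (N - 4) / 4 = 0 by ring]
      simp [bipolarPow, Real.rpow_neg_one]
  obtain ⟨hKi, hK⟩ := integral_ground_state hft hαs hβs
  set K : EuclideanSpace ℝ (Fin N) → ℝ := fun x =>
    α x * f x * Laplacian.laplacian (fun y => β y * f y) x + α x * β x * ∑ i, (pd i f x) ^ 2 -
      (1 / 2) * (f x) ^ 2 * (α x * Laplacian.laplacian β x + β x * Laplacian.laplacian α x)
    with hKdef
  have hWi := hu.integrable_weight
  have hDi := hu.integrable_grad
  have hvi : Integrable (fun x => (‖x - a₁‖ ^ 2 * Laplacian.laplacian v x) ^ 2) := by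
    simp only [pow_two (‖_‖ ^ 2 * Laplacian.laplacian v _)]
    exact (IsTestFun.smooth_mul ((contDiff_normSq_sub a₁).mul (laplacian_contDiff hvt.1))
      (.smooth_mul (contDiff_normSq_sub a₁) hvt.laplacian)).integrable
  have hpt : ∀ x, γ ^ 2 * (bipolarWeight a₁ a₂ x * (u x) ^ 2) +
      (2 * γ * ‖a₁ - a₂‖ ^ 2) * (bipolarPow a₁ a₂ (1 - N / 2) (1 - N / 2) x *
        ∑ i, (pd i f x) ^ 2) - (2 * γ * ‖a₁ - a₂‖ ^ 2) * K x ≤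
      (‖x - a₁‖ ^ 2 * Laplacian.laplacian v x) ^ 2 := by
    intro x
    by_cases hx : x ∈ tsupport f
    · obtain ⟨h₁, h₂⟩ := hu.ne (hfs hx)
      have hs₁ := normSq_sub_pos h₁
      have hs₂ := normSq_sub_pos h₂
      have eαβ : α x * β x = bipolarPow a₁ a₂ (1 - N / 2) (1 - N / 2) x := by
        rw [hα, hβ, bipolarPow_mul h₁ h₂]; congr 1 <;> ring
      have lα : Laplacian.laplacian α x =
          -γ * ‖a₁ - a₂‖ ^ 2 * bipolarPow a₁ a₂ (-((N : ℝ) - 4) / 4 - 1) (-(N : ℝ) / 4 - 1) x := by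
        rw [hα, laplacian_bipolarPow h₁ h₂ (by ring), hγ]; ring
      have lβ : Laplacian.laplacian β x =
          -γ * ‖a₁ - a₂‖ ^ 2 * bipolarPow a₁ a₂ (-(N : ℝ) / 4 - 1) (-((N : ℝ) - 4) / 4 - 1) x := by
        rw [hβ, laplacian_bipolarPow h₁ h₂ (by ring), hγ]; ring
      have e1 : α x * Laplacian.laplacian β x + β x * Laplacian.laplacian α x =
          -2 * γ * ‖a₁ - a₂‖ ^ 2 * bipolarPow a₁ a₂ (-(N : ℝ) / 2) (-(N : ℝ) / 2) x := by
        have p1 := bipolarPow_mul h₁ h₂ (-((N : ℝ) - 4) / 4) (-(N : ℝ) / 4)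
          (-(N : ℝ) / 4 - 1) (-((N : ℝ) - 4) / 4 - 1)
        have p2 := bipolarPow_mul h₁ h₂ (-(N : ℝ) / 4) (-((N : ℝ) - 4) / 4)
          (-((N : ℝ) - 4) / 4 - 1) (-(N : ℝ) / 4 - 1)
        rw [show -((N : ℝ) - 4) / 4 + (-(N : ℝ) / 4 - 1) = -(N : ℝ) / 2 by ring,
          show -(N : ℝ) / 4 + (-((N : ℝ) - 4) / 4 - 1) = -(N : ℝ) / 2 by ring] at p1
        rw [show -((N : ℝ) - 4) / 4 + (-(N : ℝ) / 4 - 1) = -(N : ℝ) / 2 by ring,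
          show -(N : ℝ) / 4 + (-((N : ℝ) - 4) / 4 - 1) = -(N : ℝ) / 2 by ring] at p2
        rw [lα, lβ, hα, hβ]
        linear_combination (-γ * ‖a₁ - a₂‖ ^ 2) * (p1 + p2)
      have e2 : ‖a₁ - a₂‖ ^ 4 * ((f x) ^ 2 * bipolarPow a₁ a₂ (-(N : ℝ) / 2) (-(N : ℝ) / 2) x) =
          bipolarWeight a₁ a₂ x * (u x) ^ 2 := by
        have p1 := bipolarPow_mul h₁ h₂ (((N : ℝ) - 4) / 4) (((N : ℝ) - 4) / 4)
          (((N : ℝ) - 4) / 4) (((N : ℝ) - 4) / 4)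
        have p2 := bipolarPow_mul h₁ h₂ (((N : ℝ) - 4) / 4 + ((N : ℝ) - 4) / 4)
          (((N : ℝ) - 4) / 4 + ((N : ℝ) - 4) / 4) (-(N : ℝ) / 2) (-(N : ℝ) / 2)
        rw [← p1, show ((N : ℝ) - 4) / 4 + ((N : ℝ) - 4) / 4 + (-(N : ℝ) / 2) = -2 by ring] at p2
        rw [bipolarWeight_eq, ← p2, hf, groundQuot]
        ring
      have e3 : α x * f x * Laplacian.laplacian v x =
          K x - bipolarPow a₁ a₂ (1 - N / 2) (1 - N / 2) x * ∑ i, (pd i f x) ^ 2 -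
            γ * ‖a₁ - a₂‖ ^ 2 * ((f x) ^ 2 * bipolarPow a₁ a₂ (-(N : ℝ) / 2) (-(N : ℝ) / 2) x) := by
        simp only [hKdef]
        rw [hβf, e1, eαβ]
        ring
      have e4 : bipolarWeight a₁ a₂ x * (u x) ^ 2 =
          ‖a₁ - a₂‖ ^ 4 * (v x) ^ 2 * ((‖x - a₂‖ ^ 2)⁻¹) ^ 2 := by
        simp only [hv, bipolarWeight, Real.rpow_neg_one]
        field_simp
      have e5 : α x * f x = ‖x - a₁‖ ^ 2 * v x * (‖x - a₂‖ ^ 2)⁻¹ := by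
        rw [hαf, ← huv]; ring
      -- The only inequality in the argument; everything else is an identity.
      have sq := sq_nonneg (‖x - a₁‖ ^ 2 * Laplacian.laplacian v x +
        γ * ‖a₁ - a₂‖ ^ 2 * (v x * (‖x - a₂‖ ^ 2)⁻¹))
      have e6 : (‖x - a₁‖ ^ 2 * Laplacian.laplacian v x +
          γ * ‖a₁ - a₂‖ ^ 2 * (v x * (‖x - a₂‖ ^ 2)⁻¹)) ^ 2 =
          (‖x - a₁‖ ^ 2 * Laplacian.laplacian v x) ^ 2 +
          2 * γ * ‖a₁ - a₂‖ ^ 2 * (α x * f x * Laplacian.laplacian v x) +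
          γ ^ 2 * (bipolarWeight a₁ a₂ x * (u x) ^ 2) := by
        rw [e4, e5]; ring
      rw [e6, e3] at sq
      linear_combination sq - 2 * γ ^ 2 * e2
    · have h0 : f x = 0 := image_eq_zero_of_notMem_tsupport hx
      have h1 : ∀ i, pd i f x = 0 := fun i => dirDeriv_eq_zero_of_notMem hx _
      have h2 : u x = 0 := by
        by_cases hx' : x = a₁ ∨ x = a₂
        · exact hu0 x hx'
        · have := congrFun huv x
          rw [← this, ← hβf]
          simp [h0]
      have : K x = 0 := by simp [hKdef, h0, h1]
      simp only [this, h1, h2]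
      simp only [ne_eq, OfNat.ofNat_ne_zero, not_false_eq_true, zero_pow, mul_zero,
        Finset.sum_const_zero, add_zero, sub_zero]
      positivity
  have hmono := integral_mono (((hWi.const_mul (γ ^ 2)).add
    (hDi.const_mul (2 * γ * ‖a₁ - a₂‖ ^ 2))).sub (hKi.const_mul (2 * γ * ‖a₁ - a₂‖ ^ 2))) hvi hpt
  have hsum : ∫ x, (γ ^ 2 * (bipolarWeight a₁ a₂ x * (u x) ^ 2) +
      (2 * γ * ‖a₁ - a₂‖ ^ 2) * (bipolarPow a₁ a₂ (1 - N / 2) (1 - N / 2) x *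
        ∑ i, (pd i f x) ^ 2) - (2 * γ * ‖a₁ - a₂‖ ^ 2) * K x) =
      γ ^ 2 * (∫ x, bipolarWeight a₁ a₂ x * (u x) ^ 2) +
      (2 * γ * ‖a₁ - a₂‖ ^ 2) *
        ∫ x, bipolarPow a₁ a₂ (1 - N / 2) (1 - N / 2) x * ∑ i, (pd i f x) ^ 2 := by
    have i12 : Integrable (fun x => γ ^ 2 * (bipolarWeight a₁ a₂ x * (u x) ^ 2) +
      (2 * γ * ‖a₁ - a₂‖ ^ 2) * (bipolarPow a₁ a₂ (1 - N / 2) (1 - N / 2) x *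
        ∑ i, (pd i f x) ^ 2)) := (hWi.const_mul _).add (hDi.const_mul _)
    rw [integral_sub i12 (hKi.const_mul _),
      integral_add (hWi.const_mul (γ ^ 2)) (hDi.const_mul (2 * γ * ‖a₁ - a₂‖ ^ 2)),
      integral_const_mul (γ ^ 2), integral_const_mul (2 * γ * ‖a₁ - a₂‖ ^ 2),
      integral_const_mul (2 * γ * ‖a₁ - a₂‖ ^ 2), hK]
    ring
  have hE : ∫ x, (Laplacian.laplacian u x) ^ 2 =
      ∫ x, (‖x - a₁‖ ^ 2 * Laplacian.laplacian v x) ^ 2 := by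
    rw [← integral_laplacian_normSq_mul_sq hvt a₁, huv]
  have hc : rellichConst N = γ ^ 2 := by rw [rellichConst, hγ]; ring
  rw [hE, hc, show (N : ℝ) * (N - 4) / 2 * ‖a₁ - a₂‖ ^ 2 = 2 * γ * ‖a₁ - a₂‖ ^ 2 by rw [hγ]; ring,
    ← hsum]
  exact hmono

/-! ### Approximation by test functions vanishing near the poles -/

theorem IsTestFun.exists_bound {f : EuclideanSpace ℝ (Fin N) → ℝ} (hf : IsTestFun f) :
    ∃ C : ℝ, 0 ≤ C ∧ ∀ x, |f x| ≤ C := by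
  obtain ⟨C, hC⟩ := hf.2.exists_bound_of_continuous hf.1.continuous
  exact ⟨C, (norm_nonneg _).trans (hC 0), hC⟩

theorem IsTestFun.exists_bound_pd {f : EuclideanSpace ℝ (Fin N) → ℝ} (hf : IsTestFun f) :
    ∃ C : ℝ, 0 ≤ C ∧ ∀ i x, |pd i f x| ≤ C := by
  choose C hC0 hC using fun i : Fin N => (hf.dirDeriv (EuclideanSpace.single i 1)).exists_bound
  refine ⟨∑ i, C i, Finset.sum_nonneg fun i _ => hC0 i, fun i x => (hC i x).trans ?_⟩
  exact Finset.single_le_sum (fun j _ => hC0 j) (Finset.mem_univ i)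

theorem contDiff_smul_sub (c : ℝ) (a : EuclideanSpace ℝ (Fin N)) :
    ContDiff ℝ ∞ (fun y : EuclideanSpace ℝ (Fin N) => c • (y - a)) := by fun_prop

theorem dirDeriv_comp_scale {f : EuclideanSpace ℝ (Fin N) → ℝ} (hf : ContDiff ℝ ∞ f) (c : ℝ)
    (a w x : EuclideanSpace ℝ (Fin N)) :
    dirDeriv w (fun y => f (c • (y - a))) x = c * dirDeriv w f (c • (x - a)) := by
  have h1 : HasFDerivAt (fun y : EuclideanSpace ℝ (Fin N) => c • (y - a))
      (c • ContinuousLinearMap.id ℝ _) x := ((hasFDerivAt_id x).sub_const a).const_smul c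
  have h2 := (hf.contDiffAt (x := c • (x - a))).diffAt.hasFDerivAt.comp x h1
  simp only [dirDeriv]
  have h3 : fderiv ℝ (fun y => f (c • (y - a))) x = _ := h2.fderiv
  rw [h3]
  simp

theorem laplacian_comp_scale {f : EuclideanSpace ℝ (Fin N) → ℝ} (hf : ContDiff ℝ ∞ f) (c : ℝ)
    (a x : EuclideanSpace ℝ (Fin N)) :
    Laplacian.laplacian (fun y => f (c • (y - a))) x =
      c ^ 2 * Laplacian.laplacian f (c • (x - a)) := by
  have hc : ContDiff ℝ ∞ (fun y => f (c • (y - a))) :=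
    hf.comp (contDiff_smul_sub _ a)
  rw [laplacian_eq_sum_pd hc.contDiffAt.two, laplacian_eq_sum_pd hf.contDiffAt.two, Finset.mul_sum]
  refine Finset.sum_congr rfl fun i _ => ?_
  have : pd i (fun y => f (c • (y - a))) = fun y => c * pd i f (c • (y - a)) := by
    ext y; exact dirDeriv_comp_scale hf c a _ y
  have hd : DifferentiableAt ℝ (fun y => pd i f (c • (y - a))) x :=
    (hf.dirDeriv.comp (contDiff_smul_sub c a)).contDiffAt.diffAt
  rw [this, pd, dirDeriv_mul (differentiableAt_const _) hd]
  have h2 := dirDeriv_comp_scale (hf.dirDeriv (w := EuclideanSpace.single i 1)) c a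
    (EuclideanSpace.single i 1) x
  rw [h2]
  simp [dirDeriv]
  ring

theorem eLpNorm_two_eq_sqrt {f : EuclideanSpace ℝ (Fin N) → ℝ} (hf : MemLp f 2 volume) :
    eLpNorm f 2 volume = ENNReal.ofReal (√(∫ x, (f x) ^ 2)) := by
  rw [hf.eLpNorm_eq_integral_rpow_norm (by norm_num) (by norm_num), Real.sqrt_eq_rpow]
  simp

/-- Multiplying by a cutoff at scale `t` changes the Laplacian by `O(t^{-2})` on a ball of radius
`2 t`, hence by little in `L²` when `N ≥ 5`. -/
theorem exists_cutoff (hN : 5 ≤ N) {u : EuclideanSpace ℝ (Fin N) → ℝ} (hu : IsTestFun u)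
    (a : EuclideanSpace ℝ (Fin N)) {δ ε : ℝ} (hδ : 0 < δ) (hε : 0 < ε) :
    ∃ u' : EuclideanSpace ℝ (Fin N) → ℝ, IsTestFun u' ∧ tsupport u' ⊆ tsupport u ∧
      a ∉ tsupport u' ∧ (∀ x, δ ≤ ‖x - a‖ → u' x = u x) ∧
      eLpNorm (Laplacian.laplacian u' - Laplacian.laplacian u) 2 volume ≤ ENNReal.ofReal ε := by
  let χ : ContDiffBump (0 : EuclideanSpace ℝ (Fin N)) := ⟨1, 2, one_pos, one_lt_two⟩
  have hχ : IsTestFun (χ : EuclideanSpace ℝ (Fin N) → ℝ) := ⟨χ.contDiff, χ.hasCompactSupport⟩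
  obtain ⟨A₀, hA₀, hu₀⟩ := hu.exists_bound
  obtain ⟨A₁, hA₁, hu₁⟩ := hu.exists_bound_pd
  obtain ⟨A₂, hA₂, hu₂⟩ := hu.laplacian.exists_bound
  obtain ⟨B₁, hB₁, hχ₁⟩ := hχ.exists_bound_pd
  obtain ⟨B₂, hB₂, hχ₂⟩ := hχ.laplacian.exists_bound
  -- Collects the Leibniz terms of `Δ(ηu)`: with `t ≤ 1`, all are at most their constant times
  -- `t⁻²`.
  set M : ℝ := A₀ * B₂ + 2 * (N * (A₁ * B₁)) + A₂ with hM
  have hM0 : 0 ≤ M := by positivity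
  set V : ℝ := volume.real (Metric.closedBall (0 : EuclideanSpace ℝ (Fin N)) 1) with hV
  have hV0 : 0 ≤ V := measureReal_nonneg
  set Q : ℝ := M ^ 2 * (2 ^ N * V) with hQ
  have hQ0 : 0 ≤ Q := by positivity
  obtain ⟨t, ht0, ht1, htδ, htQ⟩ : ∃ t : ℝ, 0 < t ∧ t ≤ 1 ∧ 2 * t ≤ δ ∧ Q * t ≤ ε ^ 2 := by
    refine ⟨min 1 (min (δ / 2) (ε ^ 2 / (Q + 1))), by positivity, min_le_left _ _, ?_, ?_⟩
    · have := (min_le_right 1 (min (δ / 2) (ε ^ 2 / (Q + 1)))).trans (min_le_left _ _)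
      linarith
    · have h := (min_le_right 1 (min (δ / 2) (ε ^ 2 / (Q + 1)))).trans (min_le_right _ _)
      calc Q * _ ≤ (Q + 1) * (ε ^ 2 / (Q + 1)) := by gcongr; linarith
        _ = ε ^ 2 := by field_simp
  set η : EuclideanSpace ℝ (Fin N) → ℝ := fun x => χ (t⁻¹ • (x - a)) with hη
  have hηs : ContDiff ℝ ∞ η :=
    χ.contDiff.comp (contDiff_smul_sub _ a)
  have hη0 : ∀ x, 2 * t ≤ ‖x - a‖ → η x = 0 := fun x hx => by
    refine χ.zero_of_le_dist ?_
    rw [dist_zero_right, norm_smul, norm_inv, Real.norm_of_nonneg ht0.le]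
    change 2 ≤ _
    rw [inv_mul_eq_div, le_div_iff₀ ht0]
    exact hx
  have hη1 : ∀ x, ‖x - a‖ ≤ t → η x = 1 := fun x hx => by
    refine χ.one_of_mem_closedBall ?_
    rw [mem_closedBall_zero_iff, norm_smul, norm_inv, Real.norm_of_nonneg ht0.le]
    change _ ≤ (1 : ℝ)
    rw [inv_mul_eq_div, div_le_one ht0]
    exact hx
  set w : EuclideanSpace ℝ (Fin N) → ℝ := fun x => η x * u x with hw
  have hwt : IsTestFun w := .smooth_mul hηs hu
  have hu' : IsTestFun (fun x => (1 - η x) * u x) := .smooth_mul (contDiff_const.sub hηs) hu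
  refine ⟨fun x => (1 - η x) * u x, hu', tsupport_mul_subset_right, ?_, ?_, ?_⟩
  · rw [notMem_tsupport_iff_eventuallyEq]
    filter_upwards [Metric.closedBall_mem_nhds a ht0] with x hx
    rw [mem_closedBall_iff_norm] at hx
    simp [hη1 x hx]
  · intro x hx
    simp [hη0 x (htδ.trans hx)]
  · have e : Laplacian.laplacian (fun x => (1 - η x) * u x) - Laplacian.laplacian u =
        - Laplacian.laplacian w := by
      have : u = (fun x => (1 - η x) * u x) + w := by ext x; simp [hw]; ring
      have h2 : Laplacian.laplacian u =
          Laplacian.laplacian (fun x => (1 - η x) * u x) + Laplacian.laplacian w := by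
        ext x
        conv_lhs => rw [this]
        exact (hu'.1.contDiffAt.two).laplacian_add hwt.1.contDiffAt.two
      rw [h2]; abel
    rw [e, eLpNorm_neg, eLpNorm_two_eq_sqrt (hwt.laplacian.memLp 2)]
    refine ENNReal.ofReal_le_ofReal (Real.sqrt_le_iff.2 ⟨hε.le, ?_⟩)
    have hti : 1 ≤ t⁻¹ := (one_le_inv₀ ht0).2 ht1
    have hb : ∀ x, |Laplacian.laplacian w x| ≤ M * t⁻¹ ^ 2 := by
      intro x
      have h1 : |η x| ≤ 1 := by
        rw [abs_of_nonneg χ.nonneg]; exact χ.le_one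
      have h2 : ∀ i, |pd i η x| ≤ t⁻¹ * B₁ := fun i => by
        have := dirDeriv_comp_scale χ.contDiff t⁻¹ a (EuclideanSpace.single i 1) x
        simp only [pd, hη]
        rw [this, abs_mul, abs_of_pos (inv_pos.2 ht0)]
        gcongr
        exact hχ₁ i _
      have h3 : |Laplacian.laplacian η x| ≤ t⁻¹ ^ 2 * B₂ := by
        rw [hη, laplacian_comp_scale χ.contDiff, abs_mul, abs_of_nonneg (by positivity)]
        gcongr
        exact hχ₂ _
      have h4 : |∑ i, pd i η x * pd i u x| ≤ N * (t⁻¹ * B₁ * A₁) := by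
        refine (Finset.abs_sum_le_sum_abs _ _).trans ?_
        calc ∑ i, |pd i η x * pd i u x| ≤ ∑ _i : Fin N, t⁻¹ * B₁ * A₁ := by
              refine Finset.sum_le_sum fun i _ => ?_
              rw [abs_mul]
              exact mul_le_mul (h2 i) (hu₁ i x) (abs_nonneg _) (by positivity)
          _ = N * (t⁻¹ * B₁ * A₁) := by simp
      rw [hw, laplacian_mul hηs.contDiffAt hu.1.contDiffAt]
      calc |η x * Laplacian.laplacian u x + 2 * ∑ i, pd i η x * pd i u x +
            u x * Laplacian.laplacian η x|
          ≤ |η x| * |Laplacian.laplacian u x| + 2 * |∑ i, pd i η x * pd i u x| +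
            |u x| * |Laplacian.laplacian η x| := by
            refine (abs_add_le _ _).trans ?_
            rw [abs_mul (u x)]
            gcongr
            refine (abs_add_le _ _).trans ?_
            rw [abs_mul, abs_mul 2, abs_two]
        _ ≤ 1 * A₂ + 2 * (N * (t⁻¹ * B₁ * A₁)) + A₀ * (t⁻¹ ^ 2 * B₂) := by
            gcongr
            exacts [hu₂ x, hu₀ x]
        _ ≤ t⁻¹ ^ 2 * A₂ + 2 * (N * (t⁻¹ ^ 2 * B₁ * A₁)) + A₀ * (t⁻¹ ^ 2 * B₂) := by
            have : t⁻¹ ≤ t⁻¹ ^ 2 := by nlinarith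
            gcongr
            exact hti.trans this
        _ = M * t⁻¹ ^ 2 := by rw [hM]; ring
    have hsupp : ∀ x, x ∉ Metric.closedBall a (2 * t) → (Laplacian.laplacian w x) ^ 2 = 0 := by
      intro x hx
      rw [laplacian_zero_of_eventually]
      · simp
      filter_upwards [Metric.isClosed_closedBall.isOpen_compl.mem_nhds hx] with y hy
      rw [Set.mem_compl_iff, mem_closedBall_iff_norm, not_le] at hy
      simp [hw, hη0 y hy.le]
    rw [← setIntegral_eq_integral_of_forall_compl_eq_zero (s := Metric.closedBall a (2 * t)) hsupp]
    have hvol : volume.real (Metric.closedBall a (2 * t)) = (2 * t) ^ N * V := by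
      rw [Measure.addHaar_real_closedBall' _ _ (by positivity)]
      simp [hV]
    have hle : ∫ x in Metric.closedBall a (2 * t), (Laplacian.laplacian w x) ^ 2 ≤
        (M * t⁻¹ ^ 2) ^ 2 * volume.real (Metric.closedBall a (2 * t)) := by
      refine (le_abs_self _).trans ?_
      rw [← Real.norm_eq_abs]
      refine norm_setIntegral_le_of_norm_le_const measure_closedBall_lt_top fun x _ => ?_
      rw [norm_pow, Real.norm_eq_abs]
      gcongr
      exact hb x
    refine hle.trans ?_
    rw [hvol]
    -- Here `N ≥ 5` is essential: `t^{N-4} ≤ t` because the exponent is at least one.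
    calc (M * t⁻¹ ^ 2) ^ 2 * ((2 * t) ^ N * V) = Q * (t⁻¹ ^ 4 * t ^ N) := by
          rw [hQ, mul_pow 2 t]; ring
      _ = Q * t ^ (N - 4) := by
          congr 1
          rw [show N = (N - 4) + 4 by omega, pow_add]
          simp only [Nat.add_sub_cancel]
          field_simp
      _ ≤ Q * t := by
          gcongr
          exact pow_le_of_le_one ht0.le ht1 (by omega)
      _ ≤ ε ^ 2 := htQ

theorem exists_punctured (hN : 5 ≤ N) {u : EuclideanSpace ℝ (Fin N) → ℝ} (hu : IsTestFun u)
    (a₁ a₂ : EuclideanSpace ℝ (Fin N)) {ε : ℝ} (hε : 0 < ε) :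
    ∃ v : EuclideanSpace ℝ (Fin N) → ℝ, IsPuncturedTest a₁ a₂ v ∧
      (∀ x, ε ≤ ‖x - a₁‖ → ε ≤ ‖x - a₂‖ → v x = u x) ∧
      eLpNorm (Laplacian.laplacian v - Laplacian.laplacian u) 2 volume ≤ ENNReal.ofReal ε := by
  obtain ⟨v, hv, hvs, hva, hve, hvn⟩ := exists_cutoff hN hu a₁ hε (half_pos hε)
  obtain ⟨w, hw, hws, hwa, hwe, hwn⟩ := exists_cutoff hN hv a₂ hε (half_pos hε)
  refine ⟨w, ⟨hw, fun h => hva (hws h), hwa⟩, fun x h₁ h₂ => (hwe x h₂).trans (hve x h₁), ?_⟩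
  have e : Laplacian.laplacian w - Laplacian.laplacian u =
    (Laplacian.laplacian w - Laplacian.laplacian v) +
      (Laplacian.laplacian v - Laplacian.laplacian u) := by abel
  rw [e]
  refine (eLpNorm_add_le ?_ ?_ (by norm_num)).trans ?_
  · exact ((hw.laplacian.memLp 2).sub (hv.laplacian.memLp 2)).aestronglyMeasurable
  · exact ((hv.laplacian.memLp 2).sub (hu.laplacian.memLp 2)).aestronglyMeasurable
  · refine (add_le_add hwn hvn).trans ?_
    rw [← ENNReal.ofReal_add (by positivity) (by positivity), add_halves]

theorem tendsto_integral_sq_of_tendsto_eLpNorm {f : ℕ → EuclideanSpace ℝ (Fin N) → ℝ}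
    {g : EuclideanSpace ℝ (Fin N) → ℝ} (hf : ∀ k, MemLp (f k) 2 volume) (hg : MemLp g 2 volume)
    (h : Tendsto (fun k => eLpNorm (f k - g) 2 volume) atTop (𝓝 0)) :
    Tendsto (fun k => ∫ x, (f k x) ^ 2) atTop (𝓝 (∫ x, (g x) ^ 2)) := by
  have h1 := (((Lp.tendsto_Lp_iff_tendsto_eLpNorm'' f hf g hg).2 h).norm).pow 2
  have e : ∀ (F : EuclideanSpace ℝ (Fin N) → ℝ) (hF : MemLp F 2 volume),
      ‖hF.toLp F‖ ^ 2 = ∫ x, (F x) ^ 2 := by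
    intro F hF
    rw [Lp.norm_toLp, eLpNorm_two_eq_sqrt hF, ENNReal.toReal_ofReal (Real.sqrt_nonneg _),
      Real.sq_sqrt (integral_nonneg fun x => sq_nonneg _)]
  simpa only [e] using h1

theorem sobolevExp_ne_zero (hN : 5 ≤ N) : sobolevExp N ≠ 0 := by
  have : (5 : ℝ) ≤ N := by exact_mod_cast hN
  rw [sobolevExp, Ne, ENNReal.ofReal_eq_zero, not_le]
  exact div_pos (by linarith) (by linarith)

/-- Every element of `D^{2,2}` is an a.e. limit of test functions vanishing near the poles whose
energies converge. -/
theorem HasD22Laplacian.exists_seq (hN : 5 ≤ N) {u g : EuclideanSpace ℝ (Fin N) → ℝ}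
    (h : HasD22Laplacian u g) (a₁ a₂ : EuclideanSpace ℝ (Fin N)) :
    ∃ ψ : ℕ → EuclideanSpace ℝ (Fin N) → ℝ, (∀ k, IsPuncturedTest a₁ a₂ (ψ k)) ∧
      (∀ᵐ x, Tendsto (fun k => ψ k x) atTop (𝓝 (u x))) ∧
      Tendsto (fun k => ∫ x, (Laplacian.laplacian (ψ k) x) ^ 2) atTop (𝓝 (∫ x, (g x) ^ 2)) := by
  obtain ⟨hu, hg, φ, hφ, hφu, hφg⟩ := h
  have hmeas := tendstoInMeasure_of_tendsto_eLpNorm (sobolevExp_ne_zero hN)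
    (fun k => ((hφ k).memLp (sobolevExp N)).aestronglyMeasurable) hu.aestronglyMeasurable hφu
  obtain ⟨ns, hns, hae⟩ := hmeas.exists_seq_tendsto_ae
  -- The same `1/(k+1)` bounds the radius of modification and the energy error. Thus each point off
  -- the poles is eventually unaffected, and the Laplacians keep their `L²` limit.
  choose ψ hψ hψe hψn using fun k : ℕ =>
    exists_punctured hN (hφ k) a₁ a₂ (ε := 1 / ((k : ℝ) + 1)) (by positivity)
  have hlim : Tendsto (fun k : ℕ => 1 / ((k : ℝ) + 1)) atTop (𝓝 0) :=
    tendsto_one_div_add_atTop_nhds_zero_nat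
  refine ⟨fun k => ψ (ns k), fun k => hψ _, ?_, ?_⟩
  · have hne : ∀ a : EuclideanSpace ℝ (Fin N), ∀ᵐ x : EuclideanSpace ℝ (Fin N), x ≠ a := by
      intro a
      have : Nontrivial (EuclideanSpace ℝ (Fin N)) := by
        have : Nonempty (Fin N) := ⟨⟨0, by omega⟩⟩
        infer_instance
      exact Measure.ae_ne volume a
    filter_upwards [hae, hne a₁, hne a₂] with x hx h₁ h₂
    refine hx.congr' ?_
    have ev : ∀ a : EuclideanSpace ℝ (Fin N), x ≠ a →
        ∀ᶠ k in atTop, 1 / (((ns k : ℕ) : ℝ) + 1) ≤ ‖x - a‖ := fun a ha =>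
      ((hlim.comp hns.tendsto_atTop).eventually
        (gt_mem_nhds (norm_pos_iff.2 (sub_ne_zero.2 ha)))).mono fun k hk => hk.le
    filter_upwards [ev a₁ h₁, ev a₂ h₂] with k hk₁ hk₂
    exact (hψe _ x hk₁ hk₂).symm
  · have h1 : Tendsto (fun k => eLpNorm (Laplacian.laplacian (ψ k) - g) 2 volume) atTop (𝓝 0) := by
      have h2 : Tendsto (fun k : ℕ => ENNReal.ofReal (1 / ((k : ℝ) + 1)) +
          eLpNorm (Laplacian.laplacian (φ k) - g) 2 volume) atTop (𝓝 0) := by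
        have := (ENNReal.tendsto_ofReal hlim).add hφg
        simpa using this
      refine tendsto_of_tendsto_of_tendsto_of_le_of_le tendsto_const_nhds h2
        (fun _ => zero_le) fun k => ?_
      have e : Laplacian.laplacian (ψ k) - g =
        (Laplacian.laplacian (ψ k) - Laplacian.laplacian (φ k)) +
          (Laplacian.laplacian (φ k) - g) := by abel
      simp only [e]
      refine (eLpNorm_add_le ?_ ?_ (by norm_num)).trans (add_le_add (hψn k) le_rfl)
      · exact (((hψ k).1.laplacian.memLp 2).sub ((hφ k).laplacian.memLp 2)).aestronglyMeasurable
      · exact (((hφ k).laplacian.memLp 2).sub hg).aestronglyMeasurable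
    exact (tendsto_integral_sq_of_tendsto_eLpNorm (fun k => (hψ k).1.laplacian.memLp 2) hg h1).comp
      hns.tendsto_atTop

theorem IsTestFun.hasD22Laplacian {u : EuclideanSpace ℝ (Fin N) → ℝ} (hu : IsTestFun u) :
    HasD22Laplacian u (Laplacian.laplacian u) :=
  ⟨hu.memLp _, hu.laplacian.memLp _, fun _ => u, fun _ => hu, by simp, by simp⟩

/-! ### The inequality on `D^{2,2}` -/

/-- Fatou's lemma for Bochner integrals, with integrability of the limit as part of the conclusion.
-/
theorem integrable_and_integral_le_of_tendsto_ae {X : Type*} [MeasurableSpace X] {μ : Measure X}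
    {f : ℕ → X → ℝ} {F : X → ℝ} {c : ℕ → ℝ} {C : ℝ} (h0 : ∀ k x, 0 ≤ f k x)
    (hf : ∀ k, Integrable (f k) μ) (hF : ∀ᵐ x ∂μ, Tendsto (fun k => f k x) atTop (𝓝 (F x)))
    (hle : ∀ k, ∫ x, f k x ∂μ ≤ c k) (hc : Tendsto c atTop (𝓝 C)) :
    Integrable F μ ∧ ∫ x, F x ∂μ ≤ C := by
  have hF0 : 0 ≤ᵐ[μ] F := by
    filter_upwards [hF] with x hx
    exact ge_of_tendsto' hx fun k => h0 k x
  have hm : AEStronglyMeasurable F μ :=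
    aestronglyMeasurable_of_tendsto_ae atTop (fun k => (hf k).aestronglyMeasurable) hF
  have hC0 : 0 ≤ C := ge_of_tendsto' hc fun k => (integral_nonneg (h0 k)).trans (hle k)
  have key : ∫⁻ x, ENNReal.ofReal (F x) ∂μ ≤ ENNReal.ofReal C := by
    calc ∫⁻ x, ENNReal.ofReal (F x) ∂μ
        = ∫⁻ x, liminf (fun k => ENNReal.ofReal (f k x)) atTop ∂μ := by
          refine lintegral_congr_ae ?_
          filter_upwards [hF] with x hx
          exact (ENNReal.tendsto_ofReal hx).liminf_eq.symm
      _ ≤ liminf (fun k => ∫⁻ x, ENNReal.ofReal (f k x) ∂μ) atTop :=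
          lintegral_liminf_le' fun k => (hf k).aemeasurable.ennreal_ofReal
      _ ≤ liminf (fun k => ENNReal.ofReal (c k)) atTop := by
          refine liminf_le_liminf (Eventually.of_forall fun k => ?_)
          rw [← ofReal_integral_eq_lintegral_ofReal (hf k) (Eventually.of_forall (h0 k))]
          exact ENNReal.ofReal_le_ofReal (hle k)
      _ = ENNReal.ofReal C := (ENNReal.tendsto_ofReal hc).liminf_eq
  have hint : Integrable F μ := by
    refine ⟨hm, ?_⟩
    rw [hasFiniteIntegral_iff_ofReal hF0]
    exact key.trans_lt ENNReal.ofReal_lt_top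
  refine ⟨hint, ?_⟩
  rw [← ofReal_integral_eq_lintegral_ofReal hint hF0] at key
  exact (ENNReal.ofReal_le_ofReal_iff hC0).1 key

theorem bipolarWeight_nonneg (a₁ a₂ x : EuclideanSpace ℝ (Fin N)) : 0 ≤ bipolarWeight a₁ a₂ x := by
  unfold bipolarWeight; positivity

theorem bipolarPow_nonneg (a₁ a₂ : EuclideanSpace ℝ (Fin N)) (p q : ℝ)
    (x : EuclideanSpace ℝ (Fin N)) : 0 ≤ bipolarPow a₁ a₂ p q x := by
  unfold bipolarPow; positivity

theorem rellichConst_pos (hN : 5 ≤ N) : 0 < rellichConst N := by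
  have : (5 : ℝ) ≤ N := by exact_mod_cast hN
  have h4 : (0 : ℝ) < N - 4 := by linarith
  unfold rellichConst; positivity

/-- The gradient remainder is dropped before the limit. Fatou needs only a.e. convergence of the
approximants and convergence of their energies. -/
theorem HasD22Laplacian.weighted (hN : 5 ≤ N) {u g : EuclideanSpace ℝ (Fin N) → ℝ}
    (h : HasD22Laplacian u g) (a₁ a₂ : EuclideanSpace ℝ (Fin N)) :
    Integrable (fun x => bipolarWeight a₁ a₂ x * (u x) ^ 2) ∧
      rellichConst N * ∫ x, bipolarWeight a₁ a₂ x * (u x) ^ 2 ≤ ∫ x, (g x) ^ 2 := by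
  obtain ⟨ψ, hψ, hae, hlim⟩ := h.exists_seq hN a₁ a₂
  have h4 : (0 : ℝ) ≤ N - 4 := by
    have : (5 : ℝ) ≤ N := by exact_mod_cast hN
    linarith
  have hC := rellichConst_pos hN
  have := integrable_and_integral_le_of_tendsto_ae
    (f := fun k x => rellichConst N * (bipolarWeight a₁ a₂ x * (ψ k x) ^ 2))
    (F := fun x => rellichConst N * (bipolarWeight a₁ a₂ x * (u x) ^ 2))
    (c := fun k => ∫ x, (Laplacian.laplacian (ψ k) x) ^ 2) (μ := volume)
    (fun k x => mul_nonneg hC.le (mul_nonneg (bipolarWeight_nonneg _ _ _) (sq_nonneg _)))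
    (fun k => (hψ k).integrable_weight.const_mul _)
    (by
      filter_upwards [hae] with x hx
      exact ((hx.pow 2).const_mul _).const_mul _)
    (fun k => by
      rw [integral_const_mul]
      refine le_trans ?_ (improved_rellich (hψ k))
      refine le_add_of_nonneg_right (mul_nonneg (by positivity) (integral_nonneg fun x => ?_))
      exact mul_nonneg (bipolarPow_nonneg _ _ _ _ _) (Finset.sum_nonneg fun i _ => sq_nonneg _))
    hlim
  rw [integral_const_mul] at this
  exact ⟨(integrable_const_mul_iff (isUnit_iff_ne_zero.2 hC.ne') _).1 this.1, this.2⟩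

theorem ae_ne_point (hN : 0 < N) (a : EuclideanSpace ℝ (Fin N)) :
    ∀ᵐ x : EuclideanSpace ℝ (Fin N), x ≠ a := by
  have : Nonempty (Fin N) := ⟨⟨0, hN⟩⟩
  exact Measure.ae_ne volume a

theorem integral_weight_pos (hN : 0 < N) {a₁ a₂ : EuclideanSpace ℝ (Fin N)} (ha : a₁ ≠ a₂)
    {u : EuclideanSpace ℝ (Fin N) → ℝ}
    (hi : Integrable (fun x => bipolarWeight a₁ a₂ x * (u x) ^ 2)) (hu : ¬ u =ᵐ[volume] 0) :
    0 < ∫ x, bipolarWeight a₁ a₂ x * (u x) ^ 2 := by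
  have h0 : ∀ x, 0 ≤ bipolarWeight a₁ a₂ x * (u x) ^ 2 := fun x =>
    mul_nonneg (bipolarWeight_nonneg _ _ _) (sq_nonneg _)
  refine (integral_nonneg h0).lt_of_ne fun h => hu ?_
  have hz := (integral_eq_zero_iff_of_nonneg h0 hi).1 h.symm
  filter_upwards [hz, ae_ne_point hN a₁, ae_ne_point hN a₂] with x hx h₁ h₂
  have hW : bipolarWeight a₁ a₂ x ≠ 0 := by
    have := norm_ne_zero_iff.2 (sub_ne_zero.2 ha)
    have := norm_ne_zero_iff.2 (sub_ne_zero.2 h₁)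
    have := norm_ne_zero_iff.2 (sub_ne_zero.2 h₂)
    unfold bipolarWeight; positivity
  simpa [hW] using hx

/-! ### Non-attainment -/

theorem sq_intervalIntegral_le {h : ℝ → ℝ} (hc : Continuous h) :
    (∫ t in (0 : ℝ)..1, h t) ^ 2 ≤ ∫ t in (0 : ℝ)..1, (h t) ^ 2 := by
  set c := ∫ t in (0 : ℝ)..1, h t with hcdef
  -- The variance about the mean `c` is nonnegative.
  have h1 : 0 ≤ ∫ t in (0 : ℝ)..1, (h t - c) ^ 2 :=
    intervalIntegral.integral_nonneg zero_le_one fun t _ => sq_nonneg _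
  have e : ∀ t, (h t - c) ^ 2 = (h t) ^ 2 - (2 * c * h t - c ^ 2) := fun t => by ring
  simp only [e] at h1
  rw [intervalIntegral.integral_sub
    ((by fun_prop : Continuous fun t => h t ^ 2).intervalIntegrable _ _)
    ((by fun_prop : Continuous fun t => 2 * c * h t - c ^ 2).intervalIntegrable _ _),
    intervalIntegral.integral_sub
    ((by fun_prop : Continuous fun t => 2 * c * h t).intervalIntegrable _ _)
    (by simp), intervalIntegral.integral_const_mul, ← hcdef] at h1
  simp at h1
  linarith

theorem sq_dirDeriv_le (f : EuclideanSpace ℝ (Fin N) → ℝ) (z x : EuclideanSpace ℝ (Fin N)) :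
    (dirDeriv z f x) ^ 2 ≤ ‖z‖ ^ 2 * ∑ i, (pd i f x) ^ 2 := by
  have h : z = ∑ i, z i • EuclideanSpace.single i (1 : ℝ) := by
    conv_lhs => rw [← (EuclideanSpace.basisFun (Fin N) ℝ).sum_repr z]
    simp
  have e : dirDeriv z f x = ∑ i, z i * pd i f x := by
    simp only [pd, dirDeriv]
    conv_lhs => rw [h]
    rw [map_sum]
    simp
  rw [e, EuclideanSpace.real_norm_sq_eq]
  exact Finset.sum_mul_sq_le_sq_mul_sq _ _ _

theorem sq_sub_translate_le {f : EuclideanSpace ℝ (Fin N) → ℝ} (hf : ContDiff ℝ ∞ f)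
    (z x : EuclideanSpace ℝ (Fin N)) :
    (f (x + z) - f x) ^ 2 ≤ ∫ t in (0 : ℝ)..1, ‖z‖ ^ 2 * ∑ i, (pd i f (x + t • z)) ^ 2 := by
  have hc : Continuous fun t : ℝ => dirDeriv z f (x + t • z) :=
    (hf.dirDeriv.continuous).comp (by fun_prop)
  have hder : ∀ t : ℝ, HasDerivAt (fun t : ℝ => f (x + t • z)) (dirDeriv z f (x + t • z)) t := by
    intro t
    have h1 : HasDerivAt (fun t : ℝ => x + t • z) z t := by
      simpa using ((hasDerivAt_id t).smul_const z).const_add x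
    exact (hf.contDiffAt.diffAt.hasFDerivAt (x := x + t • z)).comp_hasDerivAt t h1
  have hint : ∫ t in (0 : ℝ)..1, dirDeriv z f (x + t • z) = f (x + z) - f x := by
    rw [intervalIntegral.integral_eq_sub_of_hasDerivAt (fun t _ => hder t)
      (hc.intervalIntegrable _ _)]
    simp
  rw [← hint]
  refine (sq_intervalIntegral_le hc).trans ?_
  refine intervalIntegral.integral_mono_on zero_le_one ((hc.pow 2).intervalIntegrable _ _)
    (Continuous.intervalIntegrable ?_ _ _) fun t _ => sq_dirDeriv_le f z _
  refine continuous_const.mul (continuous_finsetSum _ fun i _ => ?_)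
  exact ((hf.dirDeriv.continuous).comp (by fun_prop)).pow 2

/-- Integrate the segment estimate `sq_sub_translate_le` over the ball and exchange the integrals:
for each `t ∈ (0, 1]` the ball shifted by `t z` stays inside the enlarged one. -/
theorem lintegral_ball_translate_le {f : EuclideanSpace ℝ (Fin N) → ℝ} (hf : ContDiff ℝ ∞ f)
    (z : EuclideanSpace ℝ (Fin N)) (R : ℝ) :
    ∫⁻ x in Metric.ball 0 R, ENNReal.ofReal ((f (x + z) - f x) ^ 2) ≤
      ∫⁻ y in Metric.ball 0 (R + ‖z‖), ENNReal.ofReal (‖z‖ ^ 2 * ∑ i, (pd i f y) ^ 2) := by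
  set S : EuclideanSpace ℝ (Fin N) → ℝ := fun y => ‖z‖ ^ 2 * ∑ i, (pd i f y) ^ 2 with hS
  have hSc : Continuous S := by
    refine continuous_const.mul (continuous_finsetSum _ fun i _ => ?_)
    exact (hf.dirDeriv.continuous).pow 2
  have hS0 : ∀ y, 0 ≤ S y := fun y => by positivity
  calc ∫⁻ x in Metric.ball 0 R, ENNReal.ofReal ((f (x + z) - f x) ^ 2)
      ≤ ∫⁻ x in Metric.ball 0 R, ∫⁻ t in Set.Ioc (0 : ℝ) 1, ENNReal.ofReal (S (x + t • z)) := by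
        refine lintegral_mono fun x => ?_
        have hcx : Continuous fun t : ℝ => S (x + t • z) := hSc.comp (by fun_prop)
        rw [← ofReal_integral_eq_lintegral_ofReal
          ((hcx.integrableOn_Icc (a := 0) (b := 1)).mono_set Set.Ioc_subset_Icc_self)
          (Eventually.of_forall fun t => hS0 _), ← intervalIntegral.integral_of_le zero_le_one]
        exact ENNReal.ofReal_le_ofReal (sq_sub_translate_le hf z x)
    _ = ∫⁻ t in Set.Ioc (0 : ℝ) 1, ∫⁻ x in Metric.ball 0 R, ENNReal.ofReal (S (x + t • z)) := by
        refine lintegral_lintegral_swap (Measurable.aemeasurable ?_)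
        exact (ENNReal.continuous_ofReal.comp (hSc.comp (by fun_prop))).measurable
    _ ≤ ∫⁻ _t in Set.Ioc (0 : ℝ) 1,
          ∫⁻ y in Metric.ball 0 (R + ‖z‖), ENNReal.ofReal (S y) := by
        refine setLIntegral_mono measurable_const fun t ht => ?_
        rw [← lintegral_indicator Metric.isOpen_ball.measurableSet,
          ← lintegral_indicator Metric.isOpen_ball.measurableSet,
          ← lintegral_add_right_eq_self ((Metric.ball 0 (R + ‖z‖)).indicator _) (t • z)]
        refine lintegral_mono fun x => ?_
        by_cases hx : x ∈ Metric.ball (0 : EuclideanSpace ℝ (Fin N)) R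
        · have hx' : x + t • z ∈ Metric.ball (0 : EuclideanSpace ℝ (Fin N)) (R + ‖z‖) := by
            rw [mem_ball_zero_iff] at hx ⊢
            refine (norm_add_le _ _).trans_lt (add_lt_add_of_lt_of_le hx ?_)
            rw [norm_smul, Real.norm_of_nonneg ht.1.le]
            exact mul_le_of_le_one_left (norm_nonneg _) ht.2
          simp [Set.indicator_of_mem hx, Set.indicator_of_mem hx']
        · simp [Set.indicator_of_notMem hx]
    _ = _ := by
        rw [lintegral_const, Measure.restrict_apply_univ, Real.volume_Ioc, sub_zero,
          ENNReal.ofReal_one, mul_one]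

/-- Fubini exchanges "for every `z`, a.e. `x`" for "a.e. `x`, a.e. `z`"; one good base point `x`
then determines the function a.e. -/
theorem ae_const_of_ae_translate {f : EuclideanSpace ℝ (Fin N) → ℝ}
    (hf : AEStronglyMeasurable f volume) (h : ∀ z, ∀ᵐ x, f (x + z) = f x) :
    ∃ c : ℝ, ∀ᵐ x, f x = c := by
  -- A measurable representative makes the set of pairs with `g (x + z) = g x` measurable, as the
  -- exchange requires.
  set g := hf.mk f with hg
  have hgm : Measurable g := hf.stronglyMeasurable_mk.measurable
  have hfg : f =ᵐ[volume] g := hf.ae_eq_mk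
  have h1 : ∀ z, ∀ᵐ x, g (x + z) = g x := fun z => by
    have h2 := (measurePreserving_add_right volume z).quasiMeasurePreserving.ae hfg
    filter_upwards [h z, hfg, h2] with x e1 e2 e3
    rw [← e2, ← e1, ← e3]
  have h3 : ∀ᵐ x : EuclideanSpace ℝ (Fin N), ∀ᵐ z, g (x + z) = g x := by
    refine (Measure.ae_ae_comm ?_).1 (Eventually.of_forall h1)
    exact measurableSet_eq_fun (hgm.comp (measurable_snd.add measurable_fst))
      (hgm.comp measurable_snd)
  obtain ⟨x, hx⟩ := h3.exists
  refine ⟨g x, ?_⟩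
  have h4 := (measurePreserving_add_left volume (-x)).quasiMeasurePreserving.ae hx
  filter_upwards [h4, hfg] with y e1 e2
  rw [e2, ← e1]
  simp

/-- Distances to the poles are bounded on a ball, so nonpositive powers of them are bounded below.
The poles are excluded since `Real.rpow` sends `0` to `0` at negative exponents. -/
theorem exists_pos_le_bipolarPow (a₁ a₂ : EuclideanSpace ℝ (Fin N)) {p q : ℝ} (hp : p ≤ 0)
    (hq : q ≤ 0) (R : ℝ) :
    ∃ m : ℝ, 0 < m ∧ ∀ y ∈ Metric.ball (0 : EuclideanSpace ℝ (Fin N)) R, y ≠ a₁ → y ≠ a₂ →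
      m ≤ bipolarPow a₁ a₂ p q y := by
  refine ⟨((|R| + ‖a₁‖ + 1) ^ 2) ^ p * ((|R| + ‖a₂‖ + 1) ^ 2) ^ q, by positivity,
    fun y hy h₁ h₂ => ?_⟩
  have h : ∀ a : EuclideanSpace ℝ (Fin N), ‖y - a‖ ^ 2 ≤ (|R| + ‖a‖ + 1) ^ 2 := fun a => by
    rw [mem_ball_zero_iff] at hy
    gcongr
    have := norm_sub_le y a
    have := le_abs_self R
    linarith
  unfold bipolarPow
  exact mul_le_mul (Real.rpow_le_rpow_of_nonpos (normSq_sub_pos h₁) (h a₁) hp)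
    (Real.rpow_le_rpow_of_nonpos (normSq_sub_pos h₂) (h a₂) hq) (by positivity) (by positivity)

/-- In polar coordinates the integrand becomes `r^{N-1} r^{-N} = 1/r` on `(0, 1)`. -/
theorem not_integrableOn_normSq_rpow (hN : 0 < N) (a : EuclideanSpace ℝ (Fin N)) :
    ¬ IntegrableOn (fun x : EuclideanSpace ℝ (Fin N) => (‖x - a‖ ^ 2) ^ (-(N : ℝ) / 2))
      (Metric.ball a 1) := by
  intro h
  have : Nonempty (Fin N) := ⟨⟨0, hN⟩⟩
  have h1 : IntegrableOn (fun x : EuclideanSpace ℝ (Fin N) => (‖x‖ ^ 2) ^ (-(N : ℝ) / 2))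
      (Metric.ball 0 1) := by
    rw [← integrable_indicator_iff Metric.isOpen_ball.measurableSet] at h ⊢
    refine (h.comp_add_right a).congr (Eventually.of_forall fun x => ?_)
    simp [Set.indicator]
  rw [integrableOn_fun_norm_addHaar volume (f := fun r => (r ^ 2) ^ (-(N : ℝ) / 2))] at h1
  have h2 : IntegrableOn (fun y : ℝ => y ^ (-1 : ℝ)) (Set.Ioo 0 1) := by
    refine h1.congr_fun (fun y hy => ?_) measurableSet_Ioo
    have hy0 : 0 < y := hy.1
    simp only [finrank_euclideanSpace, Fintype.card_fin, smul_eq_mul]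
    rw [← Real.rpow_natCast y 2, ← Real.rpow_mul hy0.le, ← Real.rpow_natCast y (N - 1),
      ← Real.rpow_add hy0, Nat.cast_sub hN]
    congr 1
    push_cast
    ring
  rw [intervalIntegral.integrableOn_Ioo_rpow_iff one_pos] at h2
  exact lt_irrefl _ h2

theorem not_integrable_bipolarPow (hN : 0 < N) (a₁ a₂ : EuclideanSpace ℝ (Fin N)) :
    ¬ Integrable (bipolarPow a₁ a₂ (-(N : ℝ) / 2) (-(N : ℝ) / 2)) := by
  intro h
  refine not_integrableOn_normSq_rpow hN a₁ ?_
  have hq : -(N : ℝ) / 2 ≤ 0 := by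
    have : (0 : ℝ) ≤ N := Nat.cast_nonneg N
    linarith
  obtain ⟨m, hm, hle⟩ := exists_pos_le_bipolarPow a₁ a₂ le_rfl hq (1 + ‖a₁‖)
  refine Integrable.mono' (h.integrableOn.const_mul m⁻¹) ?_ ?_
  · refine Measurable.aestronglyMeasurable ?_
    exact ((measurable_id.sub_const a₁).norm.pow_const 2).pow_const _
  · filter_upwards [ae_restrict_mem Metric.isOpen_ball.measurableSet,
      ae_restrict_of_ae (ae_ne_point hN a₁), ae_restrict_of_ae (ae_ne_point hN a₂)] with x hx h₁ h₂
    have hx' : x ∈ Metric.ball (0 : EuclideanSpace ℝ (Fin N)) (1 + ‖a₁‖) := by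
      rw [mem_ball_iff_norm] at hx
      rw [mem_ball_zero_iff]
      have := norm_add_le (x - a₁) a₁
      rw [sub_add_cancel] at this
      linarith
    have h3 := hle x hx' h₁ h₂
    rw [Real.norm_of_nonneg (by positivity), inv_mul_eq_div, le_div_iff₀ hm]
    simp only [bipolarPow, Real.rpow_zero, one_mul] at h3 ⊢
    gcongr

/-- Converts the remainder into a bound on finite differences, which passes to a.e. limits where
gradients need not. -/
theorem IsPuncturedTest.integral_translate_le {a₁ a₂ : EuclideanSpace ℝ (Fin N)}
    {u : EuclideanSpace ℝ (Fin N) → ℝ} (hu : IsPuncturedTest a₁ a₂ u)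
    (z : EuclideanSpace ℝ (Fin N)) {R m : ℝ}
    (hm : ∀ y ∈ Metric.ball (0 : EuclideanSpace ℝ (Fin N)) (R + ‖z‖), y ≠ a₁ → y ≠ a₂ →
      m ≤ bipolarPow a₁ a₂ (1 - N / 2) (1 - N / 2) y) (hm0 : 0 < m) :
    Integrable ((Metric.ball 0 R).indicator
        fun x => (_root_.groundQuot a₁ a₂ u (x + z) - _root_.groundQuot a₁ a₂ u x) ^ 2) ∧
      m * (∫ x, (Metric.ball 0 R).indicator
        (fun x => (_root_.groundQuot a₁ a₂ u (x + z) - _root_.groundQuot a₁ a₂ u x) ^ 2) x) ≤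
      ‖z‖ ^ 2 * ∫ x, bipolarPow a₁ a₂ (1 - N / 2) (1 - N / 2) x *
        ∑ i, (pd i (_root_.groundQuot a₁ a₂ u) x) ^ 2 := by
  set f := _root_.groundQuot a₁ a₂ u with hf
  have hft : IsTestFun f := hu.groundQuot
  set ρ := bipolarPow a₁ a₂ (1 - N / 2) (1 - N / 2) with hρ
  have hgi := hu.integrable_grad
  rw [← hf, ← hρ] at hgi
  have hρ0 : ∀ x, 0 ≤ ρ x := fun x => bipolarPow_nonneg _ _ _ _ _
  have hS0 : ∀ x, 0 ≤ ∑ i, (pd i f x) ^ 2 := fun x => Finset.sum_nonneg fun i _ => sq_nonneg _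
  have hcont : Continuous fun x => (f (x + z) - f x) ^ 2 :=
    ((hft.1.continuous.comp (by fun_prop)).sub hft.1.continuous).pow 2
  have hint : IntegrableOn (fun x => (f (x + z) - f x) ^ 2) (Metric.ball 0 R) :=
    (hcont.continuousOn.integrableOn_compact (isCompact_closedBall 0 R)).mono_set
      Metric.ball_subset_closedBall
  refine ⟨(integrable_indicator_iff Metric.isOpen_ball.measurableSet).2 hint, ?_⟩
  rw [integral_indicator Metric.isOpen_ball.measurableSet]
  have hpt : ∀ y ∈ Metric.ball (0 : EuclideanSpace ℝ (Fin N)) (R + ‖z‖),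
      ‖z‖ ^ 2 * ∑ i, (pd i f y) ^ 2 ≤ m⁻¹ * (‖z‖ ^ 2 * (ρ y * ∑ i, (pd i f y) ^ 2)) := by
    intro y hy
    by_cases hyt : y ∈ tsupport f
    · have hy' := hu.ne (tsupport_mul_subset_right hyt)
      have h1 := hm y hy hy'.1 hy'.2
      rw [inv_mul_eq_div, le_div_iff₀ hm0]
      calc ‖z‖ ^ 2 * (∑ i, (pd i f y) ^ 2) * m = ‖z‖ ^ 2 * (m * ∑ i, (pd i f y) ^ 2) := by ring
        _ ≤ _ := by
          gcongr
    · have h0 : ∀ i, pd i f y = 0 := fun i => dirDeriv_eq_zero_of_notMem hyt _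
      simp [h0]
  have hgi' : Integrable fun y => m⁻¹ * (‖z‖ ^ 2 * (ρ y * ∑ i, (pd i f y) ^ 2)) :=
    (hgi.const_mul _).const_mul _
  have hnn : ∀ y, 0 ≤ m⁻¹ * (‖z‖ ^ 2 * (ρ y * ∑ i, (pd i f y) ^ 2)) := fun y =>
    mul_nonneg (inv_nonneg.2 hm0.le) (mul_nonneg (by positivity) (mul_nonneg (hρ0 y) (hS0 y)))
  have key : ENNReal.ofReal (∫ x in Metric.ball 0 R, (f (x + z) - f x) ^ 2) ≤
      ENNReal.ofReal (∫ y, m⁻¹ * (‖z‖ ^ 2 * (ρ y * ∑ i, (pd i f y) ^ 2))) := by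
    rw [ofReal_integral_eq_lintegral_ofReal hint (Eventually.of_forall fun x => sq_nonneg _),
      ofReal_integral_eq_lintegral_ofReal hgi' (Eventually.of_forall hnn)]
    refine (lintegral_ball_translate_le hft.1 z R).trans ?_
    refine le_trans ?_ (setLIntegral_le_lintegral (Metric.ball 0 (R + ‖z‖)) _)
    exact setLIntegral_mono' Metric.isOpen_ball.measurableSet fun y hy =>
      ENNReal.ofReal_le_ofReal (hpt y hy)
  have key2 := (ENNReal.ofReal_le_ofReal_iff (integral_nonneg hnn)).1 key
  rw [integral_const_mul, integral_const_mul, inv_mul_eq_div, le_div_iff₀ hm0] at key2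
  linarith

/-- The Rellich quotient is never equal to the sharp constant on `D^{2,2} \ {0}`. -/
theorem HasD22Laplacian.eq_zero_of_eq (hN : 5 ≤ N) {a₁ a₂ : EuclideanSpace ℝ (Fin N)}
    (ha : a₁ ≠ a₂) {u g : EuclideanSpace ℝ (Fin N) → ℝ} (h : HasD22Laplacian u g)
    (heq : ∫ x, (g x) ^ 2 = rellichConst N * ∫ x, bipolarWeight a₁ a₂ x * (u x) ^ 2) :
    u =ᵐ[volume] 0 := by
  have hN0 : 0 < N := by omega
  have hNR : (5 : ℝ) ≤ N := by exact_mod_cast hN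
  obtain ⟨ψ, hψ, hae, hlim⟩ := h.exists_seq hN a₁ a₂
  have hWu := (h.weighted hN a₁ a₂).1
  have hC := rellichConst_pos hN
  set κ : ℝ := N * ((N : ℝ) - 4) / 2 * ‖a₁ - a₂‖ ^ 2 with hκ
  have hκ0 : 0 < κ := by
    have := norm_pos_iff.2 (sub_ne_zero.2 ha)
    have : (0 : ℝ) < N - 4 := by linarith
    positivity
  set f := groundQuot a₁ a₂ u with hf
  have hfae : ∀ᵐ x, Tendsto (fun k => groundQuot a₁ a₂ (ψ k) x) atTop (𝓝 (f x)) := by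
    filter_upwards [hae] with x hx
    exact hx.const_mul _
  have htr : ∀ z, ∀ᵐ x, f (x + z) = f x := by
    intro z
    have hball : ∀ n : ℕ, ∀ᵐ x, x ∈ Metric.ball (0 : EuclideanSpace ℝ (Fin N)) n →
        f (x + z) = f x := by
      intro n
      obtain ⟨m, hm0, hm⟩ := exists_pos_le_bipolarPow a₁ a₂ (p := 1 - N / 2) (q := 1 - N / 2)
        (by linarith) (by linarith) (n + ‖z‖)
      set T : ℕ → EuclideanSpace ℝ (Fin N) → ℝ := fun k => (Metric.ball 0 (n : ℝ)).indicator
        fun x => (groundQuot a₁ a₂ (ψ k) (x + z) - groundQuot a₁ a₂ (ψ k) x) ^ 2 with hT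
      set T' : EuclideanSpace ℝ (Fin N) → ℝ := (Metric.ball 0 (n : ℝ)).indicator
        fun x => (f (x + z) - f x) ^ 2 with hT'
      have hTk : ∀ k, Integrable (T k) ∧ m * (∫ x, T k x) ≤ _ := fun k =>
        (hψ k).integral_translate_le z hm hm0
      have hT0 : ∀ k x, 0 ≤ T k x := fun k x => Set.indicator_nonneg (fun _ _ => sq_nonneg _) _
      have hT'0 : ∀ x, 0 ≤ T' x := fun x => Set.indicator_nonneg (fun _ _ => sq_nonneg _) _
      have hTlim : ∀ᵐ x, Tendsto (fun k => T k x) atTop (𝓝 (T' x)) := by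
        have h2 := (measurePreserving_add_right volume z).quasiMeasurePreserving.ae hfae
        filter_upwards [hfae, h2] with x hx hx2
        by_cases hxb : x ∈ Metric.ball (0 : EuclideanSpace ℝ (Fin N)) n
        · simp only [hT, hT', Set.indicator_of_mem hxb]
          exact (hx2.sub hx).pow 2
        · simp only [hT, hT', Set.indicator_of_notMem hxb]
          exact tendsto_const_nhds
      -- Fatou is applied to the sum of the weighted square and the difference term, so convergence
      -- of the weighted integrals is not needed. The assumed equality then cancels the first
      -- summand against the limiting energy.
      have hfat := integrable_and_integral_le_of_tendsto_ae (μ := volume)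
        (f := fun k x => ‖z‖ ^ 2 * rellichConst N * (bipolarWeight a₁ a₂ x * (ψ k x) ^ 2) +
          κ * m * T k x)
        (F := fun x => ‖z‖ ^ 2 * rellichConst N * (bipolarWeight a₁ a₂ x * (u x) ^ 2) +
          κ * m * T' x)
        (c := fun k => ‖z‖ ^ 2 * ∫ x, (Laplacian.laplacian (ψ k) x) ^ 2)
        (fun k x => add_nonneg (mul_nonneg (by positivity)
          (mul_nonneg (bipolarWeight_nonneg _ _ _) (sq_nonneg _)))
          (mul_nonneg (by positivity) (hT0 k x)))
        (fun k => ((hψ k).integrable_weight.const_mul _).add ((hTk k).1.const_mul _))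
        (by
          filter_upwards [hae, hTlim] with x hx hx2
          exact (((hx.pow 2).const_mul _).const_mul _).add (hx2.const_mul _))
        (fun k => by
          rw [integral_add ((hψ k).integrable_weight.const_mul _) ((hTk k).1.const_mul _),
            integral_const_mul, integral_const_mul]
          have h1 := improved_rellich (hψ k)
          have h2 := (hTk k).2
          rw [← hκ] at h1
          have h3 := mul_le_mul_of_nonneg_left h1 (sq_nonneg ‖z‖)
          have h4 := mul_le_mul_of_nonneg_left h2 hκ0.le
          linear_combination h3 + h4)
        (hlim.const_mul (‖z‖ ^ 2))
      have hWc := hWu.const_mul (‖z‖ ^ 2 * rellichConst N)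
      have hκm : κ * m ≠ 0 := (mul_pos hκ0 hm0).ne'
      have hT'c : Integrable (fun x => κ * m * T' x) :=
        (hfat.1.sub hWc).congr (Eventually.of_forall fun x => by simp)
      have hT'i : Integrable T' :=
        (integrable_const_mul_iff (isUnit_iff_ne_zero.2 hκm) _).1 hT'c
      have hle := hfat.2
      rw [integral_add hWc hT'c, integral_const_mul, integral_const_mul, heq] at hle
      have hz : ∫ x, T' x = 0 := by
        refine le_antisymm ?_ (integral_nonneg hT'0)
        have : κ * m * ∫ x, T' x ≤ 0 := by linarith
        exact nonpos_of_mul_nonpos_right this (mul_pos hκ0 hm0)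
      filter_upwards [(integral_eq_zero_iff_of_nonneg hT'0 hT'i).1 hz] with x hx hxb
      simp only [hT', Set.indicator_of_mem hxb, Pi.zero_apply] at hx
      exact sub_eq_zero.1 (pow_eq_zero_iff (two_ne_zero)|>.1 hx)
    filter_upwards [ae_all_iff.2 hball] with x hx
    obtain ⟨n, hn⟩ := exists_nat_gt ‖x‖
    exact hx n (mem_ball_zero_iff.2 hn)
  have hfm : AEStronglyMeasurable f volume := aestronglyMeasurable_of_tendsto_ae atTop
    (fun k => (hψ k).groundQuot.1.continuous.aestronglyMeasurable) hfae
  obtain ⟨c, hc⟩ := ae_const_of_ae_translate hfm htr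
  -- With `f = c`, `u` is `c (|x - a₁| |x - a₂|)^{-(N-4)/2}` a.e., and the weight lowers the
  -- exponent of its square from `-(N-4)` to `-N`.
  have hWc : (fun x => bipolarWeight a₁ a₂ x * (u x) ^ 2) =ᵐ[volume] fun x =>
      ‖a₁ - a₂‖ ^ 4 * c ^ 2 * bipolarPow a₁ a₂ (-(N : ℝ) / 2) (-(N : ℝ) / 2) x := by
    filter_upwards [hc, ae_ne_point hN0 a₁, ae_ne_point hN0 a₂] with x hx h₁ h₂
    have p1 := bipolarPow_mul h₁ h₂ (((N : ℝ) - 4) / 4) (((N : ℝ) - 4) / 4)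
      (((N : ℝ) - 4) / 4) (((N : ℝ) - 4) / 4)
    have p2 := bipolarPow_mul h₁ h₂ (((N : ℝ) - 4) / 4 + ((N : ℝ) - 4) / 4)
      (((N : ℝ) - 4) / 4 + ((N : ℝ) - 4) / 4) (-(N : ℝ) / 2) (-(N : ℝ) / 2)
    rw [← p1, show ((N : ℝ) - 4) / 4 + ((N : ℝ) - 4) / 4 + (-(N : ℝ) / 2) = -2 by ring] at p2
    rw [bipolarWeight_eq, ← p2, ← hx, hf, groundQuot]
    ring
  have hc0 : c = 0 := by
    by_contra hne
    have ha0 := norm_ne_zero_iff.2 (sub_ne_zero.2 ha)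
    exact not_integrable_bipolarPow hN0 a₁ a₂ ((integrable_const_mul_iff
      (isUnit_iff_ne_zero.2 (by positivity)) _).1 (hWu.congr hWc))
  filter_upwards [hc, ae_ne_point hN0 a₁, ae_ne_point hN0 a₂] with x hx h₁ h₂
  rw [hc0, hf, groundQuot] at hx
  have hb : bipolarPow a₁ a₂ (((N : ℝ) - 4) / 4) (((N : ℝ) - 4) / 4) x ≠ 0 := by
    have := normSq_sub_pos h₁
    have := normSq_sub_pos h₂
    unfold bipolarPow; positivity
  simpa [hb] using hx

/-! ### Sharpness -/

/-- The function `log |x - a|`, written through the smooth function `|x - a|²`. -/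
def logDist (a x : EuclideanSpace ℝ (Fin N)) : ℝ := (1 / 2) * Real.log (‖x - a‖ ^ 2)

theorem contDiffAt_logDist {a x : EuclideanSpace ℝ (Fin N)} (h : x ≠ a) :
    ContDiffAt ℝ ∞ (logDist a) x :=
  contDiffAt_const.mul ((contDiff_normSq_sub a).contDiffAt.log (normSq_sub_pos h).ne')

theorem logDist_eq (a x : EuclideanSpace ℝ (Fin N)) : logDist a x = Real.log ‖x - a‖ := by
  rw [logDist, Real.log_pow]; push_cast; ring

theorem pd_logDist {a x : EuclideanSpace ℝ (Fin N)} (h : x ≠ a) (i : Fin N) :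
    pd i (logDist a) x = (‖x - a‖ ^ 2) ^ (-1 : ℝ) * (x i - a i) := by
  have h1 : HasFDerivAt (fun y : EuclideanSpace ℝ (Fin N) => ‖y - a‖ ^ 2)
      (fderiv ℝ (fun y : EuclideanSpace ℝ (Fin N) => ‖y - a‖ ^ 2) x) x :=
    (contDiff_normSq_sub a).contDiffAt.diffAt.hasFDerivAt
  have h2 : HasFDerivAt (logDist a) _ x := (h1.log (normSq_sub_pos h).ne').const_mul (1 / 2 : ℝ)
  have h3 := pd_normSq_sub a x i
  simp only [pd, dirDeriv] at h3 ⊢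
  rw [h2.fderiv]
  simp only [smul_apply, h3, smul_eq_mul, Real.rpow_neg_one]
  ring

theorem sum_sq_coord_sub (a x : EuclideanSpace ℝ (Fin N)) :
    ∑ i, (x i - a i) ^ 2 = ‖x - a‖ ^ 2 := by
  rw [EuclideanSpace.real_norm_sq_eq]; simp

theorem laplacian_logDist {a x : EuclideanSpace ℝ (Fin N)} (h : x ≠ a) :
    Laplacian.laplacian (logDist a) x = ((N : ℝ) - 2) * (‖x - a‖ ^ 2)⁻¹ := by
  rw [laplacian_eq_sum_pd (contDiffAt_logDist h).two]
  have hs := normSq_sub_pos h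
  have h1 : ∀ i, pd i (pd i (logDist a)) x =
      (‖x - a‖ ^ 2)⁻¹ - 2 * ((‖x - a‖ ^ 2)⁻¹) ^ 2 * (x i - a i) ^ 2 := by
    intro i
    have e : pd i (logDist a) =ᶠ[𝓝 x] fun y => (‖y - a‖ ^ 2) ^ (-1 : ℝ) * (y i - a i) := by
      filter_upwards [isOpen_ne.mem_nhds h] with y hy
      exact pd_logDist hy i
    have d1 := (contDiffAt_normSq_rpow h (-1)).diffAt
    have d2 := (contDiff_coord_sub a i).contDiffAt.diffAt (x := x)
    have e1 := dirDeriv_normSq_rpow h (-1) i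
    simp only [pd] at e e1 ⊢
    rw [(dirDeriv_congr e).eq_of_nhds, dirDeriv_mul d1 d2, dirDeriv_coord_sub, e1,
      show (EuclideanSpace.single i (1 : ℝ)) i = (1 : ℝ) by simp,
      show (-1 - 1 : ℝ) = -2 by norm_num, Real.rpow_neg_one, Real.rpow_neg hs.le, Real.rpow_two]
    field_simp
    ring
  simp only [h1, Finset.sum_sub_distrib, ← Finset.mul_sum, sum_sq_coord_sub]
  simp
  field_simp

theorem dirDeriv_comp_real {ψ : ℝ → ℝ} (hψ : ContDiff ℝ ∞ ψ) {ℓ : EuclideanSpace ℝ (Fin N) → ℝ}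
    {x : EuclideanSpace ℝ (Fin N)} (hℓ : DifferentiableAt ℝ ℓ x) (w : EuclideanSpace ℝ (Fin N)) :
    dirDeriv w (fun y => ψ (ℓ y)) x = deriv ψ (ℓ x) * dirDeriv w ℓ x := by
  have h1 := ((hψ.differentiable (by simp)) (ℓ x)).hasDerivAt.comp_hasFDerivAt x hℓ.hasFDerivAt
  have h2 : fderiv ℝ (fun y => ψ (ℓ y)) x = _ := h1.fderiv
  simp [dirDeriv, h2]

theorem ContDiff.deriv_infty {ψ : ℝ → ℝ} (hψ : ContDiff ℝ ∞ ψ) : ContDiff ℝ ∞ (deriv ψ) :=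
  (contDiff_infty_iff_deriv.1 hψ).2

theorem laplacian_comp_real {ψ : ℝ → ℝ} (hψ : ContDiff ℝ ∞ ψ)
    {ℓ : EuclideanSpace ℝ (Fin N) → ℝ} {x : EuclideanSpace ℝ (Fin N)} (hℓ : ContDiffAt ℝ ∞ ℓ x) :
    Laplacian.laplacian (fun y => ψ (ℓ y)) x =
      deriv (deriv ψ) (ℓ x) * ∑ i, (pd i ℓ x) ^ 2 + deriv ψ (ℓ x) * Laplacian.laplacian ℓ x := by
  have hc : ContDiffAt ℝ ∞ (fun y => ψ (ℓ y)) x := hψ.contDiffAt.comp x hℓ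
  rw [laplacian_eq_sum_pd hc.two, laplacian_eq_sum_pd hℓ.two,
    Finset.mul_sum, Finset.mul_sum, ← Finset.sum_add_distrib]
  refine Finset.sum_congr rfl fun i _ => ?_
  have e : pd i (fun y => ψ (ℓ y)) =ᶠ[𝓝 x] fun y => deriv ψ (ℓ y) * pd i ℓ y := by
    filter_upwards [hℓ.eventually_diffAt] with y hy
    exact dirDeriv_comp_real hψ hy _
  have d1 : DifferentiableAt ℝ (fun y => deriv ψ (ℓ y)) x :=
    (hψ.deriv_infty.contDiffAt.comp x hℓ).diffAt
  have d2 : DifferentiableAt ℝ (pd i ℓ) x := hℓ.dirDeriv.diffAt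
  have e2 := (dirDeriv_congr (w := EuclideanSpace.single i 1) e).eq_of_nhds
  rw [pd, e2, dirDeriv_mul d1 d2, dirDeriv_comp_real hψ.deriv_infty hℓ.diffAt]
  ring

/-- The almost-extremal `|x - a|^{-(N-4)/2} ψ(log |x - a|)`. -/
def logProfile (a : EuclideanSpace ℝ (Fin N)) (ψ : ℝ → ℝ) (x : EuclideanSpace ℝ (Fin N)) : ℝ :=
  (‖x - a‖ ^ 2) ^ (-((N : ℝ) - 4) / 4) * ψ (logDist a x)

/-- Emden–Fowler variables: the coefficient `2` is `(N - 2) - (N - 4)`, and `-γ` comes from the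
Laplacian of the power alone. -/
theorem laplacian_logProfile {ψ : ℝ → ℝ} (hψ : ContDiff ℝ ∞ ψ) {a x : EuclideanSpace ℝ (Fin N)}
    (h : x ≠ a) :
    Laplacian.laplacian (logProfile a ψ) x = (‖x - a‖ ^ 2) ^ (-(N : ℝ) / 4) *
      (deriv (deriv ψ) (logDist a x) + 2 * deriv ψ (logDist a x) -
        (N * ((N : ℝ) - 4) / 4) * ψ (logDist a x)) := by
  have hs := normSq_sub_pos h
  have hℓ := contDiffAt_logDist h
  have e := laplacian_mul (contDiffAt_normSq_rpow h (-((N : ℝ) - 4) / 4))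
    (hψ.contDiffAt.comp x hℓ)
  change Laplacian.laplacian (logProfile a ψ) x = _ at e
  have e1 : Laplacian.laplacian (ψ ∘ logDist a) x = _ := laplacian_comp_real hψ hℓ
  have e2 : ∀ i, pd i (ψ ∘ logDist a) x = _ := fun i => dirDeriv_comp_real hψ hℓ.diffAt _
  have e3 := fun i => pd_logDist h i
  simp only [pd] at e2 e3
  rw [e, e1, laplacian_normSq_rpow h, laplacian_logDist h]
  simp only [dirDeriv_normSq_rpow h, e2, e3]
  have p1 : (‖x - a‖ ^ 2) ^ (-((N : ℝ) - 4) / 4) =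
      (‖x - a‖ ^ 2) ^ (-(N : ℝ) / 4) * ‖x - a‖ ^ 2 := by
    rw [← Real.rpow_add_one hs.ne']; congr 1; ring
  have p2 : (‖x - a‖ ^ 2) ^ (-((N : ℝ) - 4) / 4 - 1) = (‖x - a‖ ^ 2) ^ (-(N : ℝ) / 4) := by
    congr 1; ring
  rw [p2, Real.rpow_neg_one, p1]
  have s1 : ∑ i, ((‖x - a‖ ^ 2)⁻¹ * (x i - a i)) ^ 2 = (‖x - a‖ ^ 2)⁻¹ := by
    simp only [mul_pow, ← Finset.mul_sum, sum_sq_coord_sub]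
    field_simp
  have s2 : ∑ i, 2 * (-((N : ℝ) - 4) / 4) * ((‖x - a‖ ^ 2) ^ (-(N : ℝ) / 4) * (x i - a i)) *
      (deriv ψ (logDist a x) * ((‖x - a‖ ^ 2)⁻¹ * (x i - a i))) =
      2 * (-((N : ℝ) - 4) / 4) * (‖x - a‖ ^ 2) ^ (-(N : ℝ) / 4) * deriv ψ (logDist a x) := by
    have : ∀ i, 2 * (-((N : ℝ) - 4) / 4) * ((‖x - a‖ ^ 2) ^ (-(N : ℝ) / 4) * (x i - a i)) *
      (deriv ψ (logDist a x) * ((‖x - a‖ ^ 2)⁻¹ * (x i - a i))) =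
      (2 * (-((N : ℝ) - 4) / 4) * (‖x - a‖ ^ 2) ^ (-(N : ℝ) / 4) * deriv ψ (logDist a x) *
        (‖x - a‖ ^ 2)⁻¹) * (x i - a i) ^ 2 := fun i => by ring
    simp only [this, ← Finset.mul_sum, sum_sq_coord_sub]
    rw [mul_assoc _ (‖x - a‖ ^ 2)⁻¹, inv_mul_cancel₀ hs.ne', mul_one]
  rw [s1, s2]
  simp only [Function.comp]
  have hne := norm_ne_zero_iff.2 (sub_ne_zero.2 h)
  generalize (‖x - a‖ ^ 2) ^ (-(N : ℝ) / 4) = X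
  field_simp
  ring

theorem logProfile_isTestFun (hN : 5 ≤ N) {ψ : ℝ → ℝ} (hψ : ContDiff ℝ ∞ ψ) {M : ℝ}
    (hM : ∀ t, M ≤ |t| → ψ t = 0) (a : EuclideanSpace ℝ (Fin N)) : IsTestFun (logProfile a ψ) := by
  have hNR : (5 : ℝ) ≤ N := by exact_mod_cast hN
  refine ⟨contDiff_iff_contDiffAt.2 fun x => ?_, ?_⟩
  · by_cases hx : x = a
    · subst hx
      have h0 : logProfile x ψ =ᶠ[𝓝 x] fun _ => 0 := by
        filter_upwards [Metric.ball_mem_nhds x (Real.exp_pos (-|M|))] with y hy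
        by_cases hyx : y = x
        -- At the pole itself the value is `0` because `0` raised to a nonzero real exponent is `0`.
        · rw [logProfile, hyx]
          have : -((N : ℝ) - 4) / 4 ≠ 0 := by
            intro h
            linarith
          rw [sub_self, norm_zero, zero_pow two_ne_zero, Real.zero_rpow this, zero_mul]
        · rw [logProfile, hM, mul_zero]
          rw [mem_ball_iff_norm] at hy
          have h1 := Real.log_lt_log (norm_pos_iff.2 (sub_ne_zero.2 hyx)) hy
          rw [Real.log_exp] at h1
          rw [logDist_eq]
          have := neg_abs_le (Real.log ‖y - x‖)
          have := le_abs_self M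
          linarith
      exact contDiffAt_const.congr_of_eventuallyEq h0
    · exact (contDiffAt_normSq_rpow hx _).mul (hψ.contDiffAt.comp x (contDiffAt_logDist hx))
  · refine HasCompactSupport.intro (isCompact_closedBall a (Real.exp |M|)) fun x hx => ?_
    rw [mem_closedBall_iff_norm, not_le] at hx
    rw [logProfile, hM, mul_zero]
    have h1 := Real.log_lt_log (Real.exp_pos _) hx
    rw [Real.log_exp] at h1
    rw [logDist_eq]
    have := le_abs_self (Real.log ‖x - a‖)
    have := le_abs_self M
    linarith

/-! ### Reduction to one-dimensional integrals in the logarithmic radius. -/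

theorem integral_norm_pow_inv_mul_log (hN : 0 < N) (a : EuclideanSpace ℝ (Fin N)) (G : ℝ → ℝ) :
    ∫ x : EuclideanSpace ℝ (Fin N), (‖x - a‖ ^ N)⁻¹ * G (Real.log ‖x - a‖) =
      (N * volume.real (Metric.ball (0 : EuclideanSpace ℝ (Fin N)) 1)) * ∫ t, G t := by
  have : Nonempty (Fin N) := ⟨⟨0, hN⟩⟩
  rw [integral_sub_right_eq_self
    (fun x : EuclideanSpace ℝ (Fin N) => (‖x‖ ^ N)⁻¹ * G (Real.log ‖x‖)) a,
    integral_fun_norm_addHaar volume (fun r => (r ^ N)⁻¹ * G (Real.log r))]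
  -- Substitute `y = exp t`; the measure `dy/y` becomes `dt`.
  have h1 : ∫ y in Set.Ioi (0 : ℝ), y ^ (N - 1) • ((y ^ N)⁻¹ * G (Real.log y)) = ∫ t, G t := by
    have h2 := integral_image_eq_integral_abs_deriv_smul (s := Set.univ) (f := Real.exp)
      (f' := Real.exp) MeasurableSet.univ
      (fun x _ => (Real.hasDerivAt_exp x).hasDerivWithinAt) Real.exp_injective.injOn
      (fun y => y ^ (N - 1) • ((y ^ N)⁻¹ * G (Real.log y)))
    rw [Set.image_univ, Real.range_exp, setIntegral_univ] at h2
    rw [h2]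
    refine integral_congr_ae (Eventually.of_forall fun t => ?_)
    have ht := Real.exp_pos t
    have hp : Real.exp t ^ N = Real.exp t ^ (N - 1) * Real.exp t := by
      rw [← pow_succ, Nat.sub_add_cancel hN]
    simp only [abs_of_pos ht, smul_eq_mul, Real.log_exp, hp]
    field_simp
  rw [finrank_euclideanSpace, Fintype.card_fin, h1]
  simp only [smul_eq_mul, nsmul_eq_mul]
  ring

theorem deriv_comp_affine {χ : ℝ → ℝ} (hχ : ContDiff ℝ ∞ χ) (e τ : ℝ) :
    deriv (fun t => χ (e * t + τ)) = fun t => e * deriv χ (e * t + τ) := by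
  ext t
  have h1 : HasDerivAt (fun t : ℝ => e * t + τ) e t := by
    simpa using ((hasDerivAt_id t).const_mul e).add_const τ
  have h2 := ((hχ.differentiable (by simp)) (e * t + τ)).hasDerivAt.comp t h1
  rw [show deriv (fun t => χ (e * t + τ)) t = _ from h2.deriv]
  ring

theorem integral_comp_affine (G : ℝ → ℝ) {e : ℝ} (he : 0 < e) (τ : ℝ) :
    ∫ t, G (e * t + τ) = e⁻¹ * ∫ t, G t := by
  have h := Measure.integral_comp_mul_left (fun t => G (t + τ)) e
  rw [h, integral_add_right_eq_self G τ, abs_of_pos (inv_pos.2 he), smul_eq_mul]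

theorem integral_laplacian_logProfile_sq (hN : 0 < N) {ψ : ℝ → ℝ} (hψ : ContDiff ℝ ∞ ψ)
    (a : EuclideanSpace ℝ (Fin N)) :
    ∫ x, (Laplacian.laplacian (logProfile a ψ) x) ^ 2 =
      (N * volume.real (Metric.ball (0 : EuclideanSpace ℝ (Fin N)) 1)) *
        ∫ t, (deriv (deriv ψ) t + 2 * deriv ψ t - (N * ((N : ℝ) - 4) / 4) * ψ t) ^ 2 := by
  rw [← integral_norm_pow_inv_mul_log hN a]
  refine integral_congr_ae ?_
  filter_upwards [ae_ne_point hN a] with x hx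
  have hr := norm_pos_iff.2 (sub_ne_zero.2 hx)
  rw [laplacian_logProfile hψ hx, mul_pow, logDist_eq]
  congr 1
  rw [← Real.rpow_natCast, ← Real.rpow_natCast, ← Real.rpow_natCast, ← Real.rpow_mul hr.le,
    ← Real.rpow_mul hr.le, ← Real.rpow_neg hr.le]
  congr 1
  push_cast
  ring

theorem sq_logProfile {ψ : ℝ → ℝ} {a x : EuclideanSpace ℝ (Fin N)} (hx : x ≠ a) :
    (‖x - a‖ ^ 4)⁻¹ * (logProfile a ψ x) ^ 2 =
      (‖x - a‖ ^ N)⁻¹ * (ψ (Real.log ‖x - a‖)) ^ 2 := by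
  have hr := norm_pos_iff.2 (sub_ne_zero.2 hx)
  rw [logProfile, mul_pow, logDist_eq, ← mul_assoc]
  congr 1
  rw [← Real.rpow_natCast, ← Real.rpow_natCast, ← Real.rpow_natCast, ← Real.rpow_natCast,
    ← Real.rpow_mul hr.le, ← Real.rpow_mul hr.le, ← Real.rpow_neg hr.le, ← Real.rpow_neg hr.le,
    ← Real.rpow_add hr]
  congr 1
  push_cast
  ring

/-- Test functions concentrating at a pole, whose Rellich quotients come arbitrarily close to the
constant. -/
theorem exists_almost_extremal (hN : 5 ≤ N) {a₁ a₂ : EuclideanSpace ℝ (Fin N)} (ha : a₁ ≠ a₂)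
    {ε : ℝ} (hε : 0 < ε) (hε1 : ε < 1) :
    ∃ u : EuclideanSpace ℝ (Fin N) → ℝ, IsTestFun u ∧
      0 < ∫ x, bipolarWeight a₁ a₂ x * (u x) ^ 2 ∧
      (1 - ε) * (∫ x, (Laplacian.laplacian u x) ^ 2) ≤
        (rellichConst N + ε) * ∫ x, bipolarWeight a₁ a₂ x * (u x) ^ 2 := by
  have hN0 : 0 < N := by omega
  have : Nonempty (Fin N) := ⟨⟨0, hN0⟩⟩
  have hd : 0 < ‖a₁ - a₂‖ := norm_pos_iff.2 (sub_ne_zero.2 ha)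
  set γ : ℝ := N * ((N : ℝ) - 4) / 4 with hγ
  have hC : rellichConst N = γ ^ 2 := by rw [rellichConst, hγ]; ring
  let χ : ContDiffBump (0 : ℝ) := ⟨1, 2, one_pos, one_lt_two⟩
  have hχ : ContDiff ℝ ∞ χ := χ.contDiff
  have hχc : HasCompactSupport χ := χ.hasCompactSupport
  set A : ℝ → ℝ := deriv (deriv χ) with hA
  set B : ℝ → ℝ := deriv χ with hB
  have sqi : ∀ f : ℝ → ℝ, Continuous f → HasCompactSupport f → Integrable fun t => f t ^ 2 := by
    intro f hf hfc
    simp only [pow_two]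
    exact (hf.mul hf).integrable_of_hasCompactSupport hfc.mul_left
  have iA := sqi A hχ.deriv_infty.deriv_infty.continuous hχc.deriv.deriv
  have iB := sqi B hχ.deriv_infty.continuous hχc.deriv
  have iχ := sqi χ hχ.continuous hχc
  set I : ℝ := ∫ t, (χ t) ^ 2 with hI
  have hI0 : 0 < I := by
    refine (hχ.continuous.pow 2).integral_pos_of_hasCompactSupport_nonneg_nonzero ?_
      (fun t => sq_nonneg _) (x := 0) ?_
    · exact hχc.comp_left (g := fun y : ℝ => y ^ 2) (by simp)
    · have : χ 0 = 1 := χ.one_of_mem_closedBall (by simp [χ])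
      simp [this]
  set M : ℝ := γ ^ 2 * I + 4 * (∫ t, A t ^ 2) + 16 * (∫ t, B t ^ 2) with hM
  have hM0 : 0 ≤ M := by
    have h1 : 0 ≤ ∫ t, A t ^ 2 := integral_nonneg fun t => sq_nonneg _
    have h2 : 0 ≤ ∫ t, B t ^ 2 := integral_nonneg fun t => sq_nonneg _
    positivity
  obtain ⟨e, he0, he1, heM⟩ : ∃ e : ℝ, 0 < e ∧ e ≤ 1 ∧ e * M ≤ ε * I := by
    refine ⟨min 1 (ε * I / (M + 1)), by positivity, min_le_left _ _, ?_⟩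
    calc min 1 (ε * I / (M + 1)) * M ≤ (ε * I / (M + 1)) * (M + 1) := by
          gcongr
          · exact min_le_right _ _
          · linarith
      _ = ε * I := by field_simp
  -- Since `|x - a₂| ≤ d + r` at distance `r` from `a₁`, the bipolar weight is at least `(1 - ε)
  -- r⁻⁴` there.
  obtain ⟨r₀, hr₀, hr⟩ : ∃ r₀ : ℝ, 0 < r₀ ∧ ∀ r : ℝ, 0 ≤ r → r < r₀ →
      1 - ε ≤ ‖a₁ - a₂‖ ^ 4 / (‖a₁ - a₂‖ + r) ^ 4 := by
    have hcont : ContinuousAt (fun r : ℝ => ‖a₁ - a₂‖ ^ 4 / (‖a₁ - a₂‖ + r) ^ 4) 0 := by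
      refine ContinuousAt.div (by fun_prop) (by fun_prop) ?_
      simpa using hd.ne'
    have hev := hcont.eventually (lt_mem_nhds (a := 1 - ε) (by
      beta_reduce
      rw [add_zero, div_self (pow_pos hd 4).ne']; linarith))
    obtain ⟨r₀, hr₀, h⟩ := Metric.eventually_nhds_iff.1 hev
    refine ⟨r₀, hr₀, fun r h0 h1 => (h ?_).le⟩
    rwa [dist_zero_right, Real.norm_of_nonneg h0]
  -- Chosen so that `e t + τ ≥ 2` exactly when `t ≥ log r₀`: the profile then lives within distance
  -- `r₀` of `a₁`, while `e` remains free to be small.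
  set τ : ℝ := 2 - e * Real.log r₀ with hτ
  have hχ0 : ∀ t, 2 ≤ |t| → χ t = 0 := fun t ht =>
    χ.zero_of_le_dist (by rw [dist_zero_right]; exact ht)
  set ψ : ℝ → ℝ := fun t => χ (e * t + τ) with hψ
  have hψs : ContDiff ℝ ∞ ψ := hχ.comp (by fun_prop)
  have hψ0 : ∀ t, (2 + |τ|) / e ≤ |t| → ψ t = 0 := fun t ht => by
    refine hχ0 _ ?_
    rw [div_le_iff₀ he0] at ht
    have h1 := abs_sub_abs_le_abs_sub (e * t) (-τ)
    rw [abs_mul, abs_of_pos he0, abs_neg, sub_neg_eq_add] at h1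
    linarith
  have hψ1 : ∀ t, Real.log r₀ ≤ t → ψ t = 0 := fun t ht => by
    refine hχ0 _ ((le_abs_self _).trans' ?_)
    have := mul_le_mul_of_nonneg_left ht he0.le
    linarith
  have hu : IsTestFun (logProfile a₁ ψ) := logProfile_isTestFun hN hψs hψ0 a₁
  set K : ℝ := N * volume.real (Metric.ball (0 : EuclideanSpace ℝ (Fin N)) 1) with hK
  have hK0 : 0 < K := by
    have h1 : 0 < volume.real (Metric.ball (0 : EuclideanSpace ℝ (Fin N)) 1) :=
      ENNReal.toReal_pos (Metric.measure_ball_pos _ _ one_pos).ne' measure_ball_lt_top.ne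
    positivity
  have hup : ∫ x, (Laplacian.laplacian (logProfile a₁ ψ) x) ^ 2 ≤
      K * e⁻¹ * (I * (γ ^ 2 + ε)) := by
    rw [integral_laplacian_logProfile_sq hN0 hψs, ← hK, ← hγ]
    have e1 : deriv ψ = fun t => e * B (e * t + τ) := deriv_comp_affine hχ e τ
    have e2 : deriv (deriv ψ) = fun t => e * (e * A (e * t + τ)) := by
      rw [e1]
      ext t
      have := congrFun (deriv_comp_affine hχ.deriv_infty e τ) t
      rw [deriv_const_mul_field]
      rw [← hB] at this
      rw [this]
    have e3 : ∫ t, (deriv (deriv ψ) t + 2 * deriv ψ t - γ * ψ t) ^ 2 =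
        e⁻¹ * ∫ t, (e * (e * A t) + 2 * (e * B t) - γ * χ t) ^ 2 := by
      rw [← integral_comp_affine _ he0 τ, e2, e1]
    rw [e3, ← mul_assoc]
    refine mul_le_mul_of_nonneg_left ?_ (by positivity)
    have hint : Integrable fun t => (1 + e) * γ ^ 2 * χ t ^ 2 +
        (4 * e * A t ^ 2 + 16 * e * B t ^ 2) :=
      (iχ.const_mul _).add ((iA.const_mul _).add (iB.const_mul _))
    have hint2 : Integrable fun t => 4 * e * A t ^ 2 + 16 * e * B t ^ 2 :=
      (iA.const_mul _).add (iB.const_mul _)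
    calc ∫ t, (e * (e * A t) + 2 * (e * B t) - γ * χ t) ^ 2
        ≤ ∫ t, ((1 + e) * γ ^ 2 * χ t ^ 2 + (4 * e * A t ^ 2 + 16 * e * B t ^ 2)) := by
          refine integral_mono_of_nonneg (Eventually.of_forall fun t => sq_nonneg _) hint
            (Eventually.of_forall fun t => ?_)
          -- Young's inequality `(X - eY)² ≤ (1 + e) X² + e(1 + e) Y²` with `X = γχ` and `Y = eA +
          -- 2B`. This and `e ≤ 1` give the coefficients `4` and `16` in `M`.
          have h1 : 0 ≤ e * (γ * χ t + (e * A t + 2 * B t)) ^ 2 := by positivity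
          have h2 : e * (1 + e) * (e * A t + 2 * B t) ^ 2 ≤
              e * 2 * (2 * A t ^ 2 + 8 * B t ^ 2) := by
            have h3 : (e * A t + 2 * B t) ^ 2 ≤ 2 * A t ^ 2 + 8 * B t ^ 2 := by
              have h4 : e ^ 2 * A t ^ 2 ≤ 1 * A t ^ 2 :=
                mul_le_mul_of_nonneg_right (pow_le_one₀ he0.le he1) (sq_nonneg _)
              linear_combination 2 * h4 + sq_nonneg (e * A t - 2 * B t)
            gcongr
            linarith
          linear_combination h1 + h2
      _ = γ ^ 2 * I + e * M := by
          rw [integral_add (iχ.const_mul _) hint2,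
            integral_add (iA.const_mul _) (iB.const_mul _), integral_const_mul,
            integral_const_mul, integral_const_mul, ← hI, hM]
          ring
      _ ≤ I * (γ ^ 2 + ε) := by linarith
  have hWi := (hu.hasD22Laplacian.weighted hN a₁ a₂).1
  have hlow : (1 - ε) * (K * e⁻¹ * I) ≤
      ∫ x, bipolarWeight a₁ a₂ x * (logProfile a₁ ψ x) ^ 2 := by
    have h1 := integral_norm_pow_inv_mul_log hN0 a₁ (fun t => (ψ t) ^ 2)
    rw [← hK, show ∫ t, (ψ t) ^ 2 = e⁻¹ * I from integral_comp_affine (fun t => χ t ^ 2) he0 τ,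
      ← mul_assoc] at h1
    rw [← h1, ← integral_const_mul]
    refine integral_mono_of_nonneg (Eventually.of_forall fun x => ?_) hWi ?_
    · have : 0 ≤ 1 - ε := by linarith
      positivity
    · filter_upwards [ae_ne_point hN0 a₁, ae_ne_point hN0 a₂] with x hx hx₂
      have hx0 := norm_pos_iff.2 (sub_ne_zero.2 hx)
      have hx2 := norm_pos_iff.2 (sub_ne_zero.2 hx₂)
      by_cases hxr : ‖x - a₁‖ < r₀
      · rw [← sq_logProfile hx, ← mul_assoc]
        gcongr
        refine (mul_le_mul_of_nonneg_right (hr _ hx0.le hxr) (by positivity)).trans ?_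
        have h2 : ‖x - a₂‖ ≤ ‖a₁ - a₂‖ + ‖x - a₁‖ := by
          have := norm_add_le (a₁ - a₂) (x - a₁)
          rwa [sub_add_sub_comm, add_comm a₁ x, add_sub_add_right_eq_sub] at this
        rw [bipolarWeight, ← div_eq_mul_inv, div_div]
        rw [mul_comm (‖x - a₁‖ ^ 4)]
        gcongr
      · rw [hψ1 _ (Real.log_le_log hr₀ (not_lt.1 hxr))]
        simp only [ne_eq, OfNat.ofNat_ne_zero, not_false_eq_true, zero_pow, mul_zero]
        exact mul_nonneg (bipolarWeight_nonneg _ _ _) (sq_nonneg _)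
  have hε2 : 0 < 1 - ε := by linarith
  refine ⟨logProfile a₁ ψ, hu, lt_of_lt_of_le (by positivity) hlow, ?_⟩
  calc (1 - ε) * (∫ x, (Laplacian.laplacian (logProfile a₁ ψ) x) ^ 2)
      ≤ (1 - ε) * (K * e⁻¹ * (I * (γ ^ 2 + ε))) := by gcongr
    _ = (γ ^ 2 + ε) * ((1 - ε) * (K * e⁻¹ * I)) := by ring
    _ ≤ _ := by
      rw [hC]
      gcongr

end

/-! ### Assembly of the inequality, sharpness and non-attainment. -/

theorem corollary1p4 (N : ℕ) (hN : 5 ≤ N) (a₁ a₂ : EuclideanSpace ℝ (Fin N)) (ha : a₁ ≠ a₂) :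
    -- the inequality on `C_0^∞(ℝ^N)`, both sides being finite
    (∀ u : EuclideanSpace ℝ (Fin N) → ℝ, IsTestFun u →
      Integrable (fun x => (Laplacian.laplacian u x) ^ 2) ∧
      Integrable (fun x => bipolarWeight a₁ a₂ x * (u x) ^ 2) ∧
      rellichConst N * ∫ x, bipolarWeight a₁ a₂ x * (u x) ^ 2 ≤
        ∫ x, (Laplacian.laplacian u x) ^ 2) ∧
    -- sharpness: the constant is the infimum of the quotient over `D^{2,2}(ℝ^N) \ {0}`,
    -- whose denominators are finite and positive
    (∀ u g : EuclideanSpace ℝ (Fin N) → ℝ, HasD22Laplacian u g → ¬ u =ᵐ[volume] 0 →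
      Integrable (fun x => bipolarWeight a₁ a₂ x * (u x) ^ 2) ∧
      0 < ∫ x, bipolarWeight a₁ a₂ x * (u x) ^ 2) ∧
    IsGLB {r : ℝ | ∃ u g : EuclideanSpace ℝ (Fin N) → ℝ,
        HasD22Laplacian u g ∧ ¬ u =ᵐ[volume] 0 ∧
        r = (∫ x, (g x) ^ 2) / ∫ x, bipolarWeight a₁ a₂ x * (u x) ^ 2}
      (rellichConst N) ∧
    -- the infimum is not attained
    ¬ ∃ u g : EuclideanSpace ℝ (Fin N) → ℝ,
        HasD22Laplacian u g ∧ ¬ u =ᵐ[volume] 0 ∧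
        ∫ x, (g x) ^ 2 = rellichConst N * ∫ x, bipolarWeight a₁ a₂ x * (u x) ^ 2 := by
  have hN0 : 0 < N := by omega
  have hpos : ∀ u g : EuclideanSpace ℝ (Fin N) → ℝ, HasD22Laplacian u g → ¬ u =ᵐ[volume] 0 →
      0 < ∫ x, bipolarWeight a₁ a₂ x * (u x) ^ 2 := fun u g h hu =>
    integral_weight_pos hN0 ha (h.weighted hN a₁ a₂).1 hu
  refine ⟨fun u hu => ⟨(hu.laplacian.memLp 2).integrable_sq, ?_⟩,
    fun u g h hu => ⟨(h.weighted hN a₁ a₂).1, hpos u g h hu⟩, ⟨?_, ?_⟩, ?_⟩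
  · exact hu.hasD22Laplacian.weighted hN a₁ a₂
  · rintro r ⟨u, g, h, hu, rfl⟩
    rw [le_div_iff₀ (hpos u g h hu)]
    exact (h.weighted hN a₁ a₂).2
  · intro b hb
    -- A lower bound `b` is tested on the almost extremals, with no assumption on its sign; letting
    -- `ε → 0⁺` gives `b ≤ rellichConst N`.
    have key : ∀ᶠ ε : ℝ in 𝓝[>] 0, b * (1 - ε) ≤ rellichConst N + ε := by
      filter_upwards [Ioo_mem_nhdsGT (zero_lt_one (α := ℝ))] with ε hε
      obtain ⟨u, hu, hW, hle⟩ := exists_almost_extremal hN ha hε.1 hε.2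
      have hne : ¬ u =ᵐ[volume] 0 := fun h0 => by
        refine hW.ne' ((integral_congr_ae ?_).trans (integral_zero _ ℝ))
        filter_upwards [h0] with x hx
        simp [hx]
      have h1 := hb ⟨u, _, hu.hasD22Laplacian, hne, rfl⟩
      rw [le_div_iff₀ hW] at h1
      have h2 : (b * (1 - ε)) * (∫ x, bipolarWeight a₁ a₂ x * (u x) ^ 2) ≤
          (rellichConst N + ε) * ∫ x, bipolarWeight a₁ a₂ x * (u x) ^ 2 := by
        have := mul_le_mul_of_nonneg_left h1 (sub_nonneg.2 hε.2.le)
        linarith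
      exact le_of_mul_le_mul_right h2 hW
    have l1 : Tendsto (fun ε : ℝ => b * (1 - ε)) (𝓝[>] 0) (𝓝 b) := by
      have : Continuous fun ε : ℝ => b * (1 - ε) := by fun_prop
      simpa using (this.tendsto 0).mono_left nhdsWithin_le_nhds
    have l2 : Tendsto (fun ε : ℝ => rellichConst N + ε) (𝓝[>] 0) (𝓝 (rellichConst N)) := by
      have : Continuous fun ε : ℝ => rellichConst N + ε := by fun_prop
      simpa using (this.tendsto 0).mono_left nhdsWithin_le_nhds
    exact le_of_tendsto_of_tendsto l1 l2 key
  · rintro ⟨u, g, h, hu, heq⟩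
    exact hu (h.eq_zero_of_eq hN ha heq)
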